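/- For a graph $G=(V,E)$ and $S\subseteq V$, let $\delta(S)$ be the set of edges with exactly one end point in $S$. The Connected Maximum Cut problem (CMC) asks, given a finite nonempty undirected simple graph $G$, for a nonempty set $S\subseteq V$ such that the induced subgraph $G[S]$ is connected and $|\delta(S)|$ is maximum among all such sets. A tree decomposition of $G$ is a finite tree $T$ with a bag $B_b\subseteq V$ for each node $b$ of $T$ such that $\bigcup_b B_b=V$, both end points of every edge lie in a common bag, and for every $u\in V$ the nodes $b$ with $u\in B_b$ induce a connected subgraph of $T$; its width is $\max_b|B_b|-1$, and the treewidth of $G$ is the minimum width of a tree decomposition of $G$. Theorem. CMC can be solved optimally in polynomial time on graphs of constant treewidth. That is, for every $t\in\mathbb N$ there are an algorithm $P_t$ and a polynomial $p_t$ such that, for every graph $G$ with vertex set $\{0,\dots,n-1\}$, $n\ge 1$, and treewidth at most $t$, the algorithm $P_t$, given only $n$ and the adjacency matrix of $G$, halts after at most $p_t(n)$ steps and outputs an optimal solution $S$ of CMC on $G$. Here an algorithm is a program of a random access machine with natural number registers and arrays (with indirect addressing), whose elementary operations (loading a constant, reading or writing a register or an array cell, addition, truncated subtraction, branching on zero)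 take one step each; there is no multiplication, so polynomial time means the same as on Turing machines. -/

import Mathlib

namespace ConnMaxCut

/-! ## Tree decompositions and treewidth -/

/-- The tree `T` with the bags `bag i` (`i` a node of `T`) is a tree decomposition of `G`:
the bags cover the vertices, every edge lies in some bag, and for each vertex `u` the nodes whose
bags contain `u` induce a connected subgraph of `T`. -/
structure IsTreeDecomposition {V ι : Type*} (G : SimpleGraph V) (T : SimpleGraph ι)
    (bag : ι → Finset V) : Prop where
  isTree : T.IsTree
  cover : ∀ v : V, ∃ i, v ∈ bag i
  edge : ∀ u v : V, G.Adj u v → ∃ i, u ∈ bag i ∧ v ∈ bag i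
  connected : ∀ u : V, (T.induce {i | u ∈ bag i}).Connected

/-- `G` has a tree decomposition over a finite tree (with nodes `0, …, m - 1`) of width at most
`w`, that is, with all bags of size at most `w + 1`. -/
def HasTreeDecompositionOfWidth {V : Type*} (G : SimpleGraph V) (w : ℕ) : Prop :=
  ∃ (m : ℕ) (T : SimpleGraph (Fin m)) (bag : Fin m → Finset V),
    IsTreeDecomposition G T bag ∧ ∀ i, (bag i).card ≤ w + 1

/-- The treewidth of a finite nonempty graph: the least width of a tree decomposition. -/
noncomputable def treewidth {V : Type*} (G : SimpleGraph V) : ℕ :=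
  sInf {w | HasTreeDecompositionOfWidth G w}

/-! ## Connected Maximum Cut -/

/-- The cut `δ(S)`: the edges of `G` with exactly one end point in `S`. -/
def cut {V : Type*} (G : SimpleGraph V) (S : Set V) : Set (Sym2 V) :=
  {e | e ∈ G.edgeSet ∧ (∃ u ∈ e, u ∈ S) ∧ ∃ v ∈ e, v ∉ S}

/-- `S` is an optimal solution of Connected Maximum Cut on the finite graph `G`: the induced
subgraph `G[S]` is connected (in particular `S` is nonempty), and no set inducing a connected
subgraph has more edges in its cut. -/
def IsOptimalCMC {V : Type*} (G : SimpleGraph V) (S : Set V) : Prop :=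
  (G.induce S).Connected ∧
    ∀ S' : Set V, (G.induce S').Connected → (cut G S').ncard ≤ (cut G S).ncard

/-! ## Random access machines

The programs below are structured random access machine programs. A machine has natural number
registers and natural number arrays with indirect addressing; a given program refers to finitely
many of them. Every elementary operation takes one step. The only arithmetic operations are
addition and truncated subtraction (no multiplication), so the bit length of every number grows at
most linearly in the number of steps, and running times are polynomially related to those of
Turing machines. -/

namespace RAM

/-- The memory: `reg x` is the content of register `x`, and `arr a i` is that of cell `i` of
array `a`. -/
@[ext] structure State where
  reg : ℕ → ℕ
  arr : ℕ → ℕ → ℕ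

/-- Overwrite register `x` by `v`. -/
def State.setReg (σ : State) (x v : ℕ) : State where
  reg := Function.update σ.reg x v
  arr := σ.arr

/-- Overwrite cell `i` of array `a` by `v`. -/
def State.setArr (σ : State) (a i v : ℕ) : State where
  reg := σ.reg
  arr := Function.update σ.arr a (Function.update (σ.arr a) i v)

/-- Expressions: constants, registers, array cells with a computed address, sums, and truncated
differences. -/
inductive Expr where
  | lit (c : ℕ)
  | reg (x : ℕ)
  | arr (a : ℕ) (i : Expr)
  | add (e₁ e₂ : Expr)
  | sub (e₁ e₂ : Expr)

/-- The value of an expression. -/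
def Expr.eval (σ : State) : Expr → ℕ
  | .lit c => c
  | .reg x => σ.reg x
  | .arr a i => σ.arr a (i.eval σ)
  | .add e₁ e₂ => e₁.eval σ + e₂.eval σ
  | .sub e₁ e₂ => e₁.eval σ - e₂.eval σ

/-- The number of steps that evaluating an expression takes: one for each elementary operation
(fetching a constant, reading a register or a cell, adding, subtracting). -/
def Expr.cost : Expr → ℕ
  | .lit _ => 1
  | .reg _ => 1
  | .arr _ i => i.cost + 1
  | .add e₁ e₂ => e₁.cost + e₂.cost + 1
  | .sub e₁ e₂ => e₁.cost + e₂.cost + 1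

/-- Programs. -/
inductive Program where
  /-- do nothing -/
  | skip
  /-- assign the value of `e` to register `x` -/
  | assign (x : ℕ) (e : Expr)
  /-- write the value of `e` into the cell of array `a` whose index is the value of `i` -/
  | store (a : ℕ) (i e : Expr)
  /-- run `p`, then `q` -/
  | seq (p q : Program)
  /-- run `p` if `e` is nonzero, and `q` otherwise -/
  | branch (e : Expr) (p q : Program)
  /-- as long as `e` is nonzero, run `p` -/
  | loop (e : Expr) (p : Program)

/-- `Exec p σ k τ`: started in memory `σ`, the program `p` halts after exactly `k` steps, with
memory `τ`. -/
inductive Exec : Program → State → ℕ → State → Prop where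
  | skip (σ : State) : Exec .skip σ 1 σ
  | assign (x : ℕ) (e : Expr) (σ : State) :
      Exec (.assign x e) σ (e.cost + 1) (σ.setReg x (e.eval σ))
  | store (a : ℕ) (i e : Expr) (σ : State) :
      Exec (.store a i e) σ (i.cost + e.cost + 1) (σ.setArr a (i.eval σ) (e.eval σ))
  | seq {p q : Program} {σ ρ τ : State} {k l : ℕ} :
      Exec p σ k ρ → Exec q ρ l τ → Exec (.seq p q) σ (k + l) τ
  | branch_true {e : Expr} {p q : Program} {σ τ : State} {k : ℕ} :
      e.eval σ ≠ 0 → Exec p σ k τ → Exec (.branch e p q) σ (e.cost + 1 + k) τ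
  | branch_false {e : Expr} {p q : Program} {σ τ : State} {k : ℕ} :
      e.eval σ = 0 → Exec q σ k τ → Exec (.branch e p q) σ (e.cost + 1 + k) τ
  | loop_done {e : Expr} {p : Program} {σ : State} :
      e.eval σ = 0 → Exec (.loop e p) σ (e.cost + 1) σ
  | loop_step {e : Expr} {p : Program} {σ ρ τ : State} {k l : ℕ} :
      e.eval σ ≠ 0 → Exec p σ k ρ → Exec (.loop e p) ρ l τ →
      Exec (.loop e p) σ (e.cost + 1 + k + l) τ

/-- Machines are deterministic: the running time and the final memory are determined by the
program and the initial memory. -/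
theorem Exec.deterministic {p : Program} {σ τ τ' : State} {k k' : ℕ}
    (h : Exec p σ k τ) (h' : Exec p σ k' τ') : k = k' ∧ τ = τ' := by
  induction h generalizing k' τ' with
  | skip σ => cases h'; exact ⟨rfl, rfl⟩
  | assign x e σ => cases h'; exact ⟨rfl, rfl⟩
  | store a i e σ => cases h'; exact ⟨rfl, rfl⟩
  | seq _ _ ih₁ ih₂ =>
    cases h' with
    | seq g₁ g₂ =>
      obtain ⟨rfl, rfl⟩ := ih₁ g₁
      obtain ⟨rfl, rfl⟩ := ih₂ g₂
      exact ⟨rfl, rfl⟩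
  | branch_true hc _ ih =>
    cases h' with
    | branch_true _ g => obtain ⟨rfl, rfl⟩ := ih g; exact ⟨rfl, rfl⟩
    | branch_false hc' _ => exact absurd hc' hc
  | branch_false hc _ ih =>
    cases h' with
    | branch_true hc' _ => exact absurd hc hc'
    | branch_false _ g => obtain ⟨rfl, rfl⟩ := ih g; exact ⟨rfl, rfl⟩
  | loop_done hc =>
    cases h' with
    | loop_done _ => exact ⟨rfl, rfl⟩
    | loop_step hc' _ _ => exact absurd hc hc'
  | loop_step hc _ _ ih₁ ih₂ =>
    cases h' with
    | loop_done hc' => exact absurd hc' hc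
    | loop_step _ g₁ g₂ =>
      obtain ⟨rfl, rfl⟩ := ih₁ g₁
      obtain ⟨rfl, rfl⟩ := ih₂ g₂
      exact ⟨rfl, rfl⟩

open Classical in
/-- The initial memory for a graph `G` with vertices `0, …, n - 1`: register `0` holds `n`, cell
`u * n + v` of array `0` holds `1` if `u` and `v` are adjacent (the adjacency matrix, row by row),
and everything else is `0`. -/
noncomputable def input {n : ℕ} (G : SimpleGraph (Fin n)) : State where
  reg := fun x => if x = 0 then n else 0
  arr := fun a k =>
    if a = 0 ∧ ∃ u v : Fin n, k = (u : ℕ) * n + (v : ℕ) ∧ G.Adj u v then 1 else 0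

/-- The vertex set that a final memory represents: its indicator vector is read off array `1`. -/
def output (n : ℕ) (τ : State) : Set (Fin n) :=
  {v | τ.arr 1 (v : ℕ) ≠ 0}

end RAM

/-- The program `P` solves Connected Maximum Cut optimally in polynomial time on the class `C` of
finite nonempty graphs: there is a polynomial `p` such that on every graph of the class with `n`
vertices `P` halts after at most `p(n)` steps and outputs an optimal solution. -/
def SolvesCMCInPolyTime (P : RAM.Program) (C : ∀ n : ℕ, SimpleGraph (Fin n) → Prop) : Prop :=
  ∃ p : Polynomial ℕ, ∀ n : ℕ, 0 < n → ∀ G : SimpleGraph (Fin n), C n G →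
    ∃ (k : ℕ) (τ : RAM.State), RAM.Exec P (RAM.input G) k τ ∧ k ≤ p.eval n ∧
      IsOptimalCMC G (RAM.output n τ)

end ConnMaxCut

/-! CMC becomes the maximisation of a sum of weights over ordered pairs of labelled vertices, in
which only equal or adjacent vertices interact. For a guessed root, a label holds a level and a
parent. Vertices of positive level form `S`, and each of them except the root earns its reward by
having a parent of smaller positive level among its neighbours. The weights live on separated
scales: one reward exceeds all that cut and tie-breaker can contribute, a cut edge counts `2 ^ n`,
and membership of `u` counts `2 ^ u`. An optimal labelling therefore satisfies every constraint,
then maximises the cut, and the last `n` binary digits of the optimal value spell out `S`, so no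
backtracking is needed (`isOptimalCMC_bits`).

No tree decomposition is ever computed. A state of the dynamic program consists of at most `k = t +
1` literals, coded by `q`, and a component `C` of the graph without their vertices. A move labels
one vertex `v` of `C` and keeps literals of `q` whose vertices, with `v`, still separate `C`. The
pairs of `v` with the separator are paid for, and the rest of `C` falls apart into independent
components (`weight_eq_add`, `weight_eq_sum`). Moves describe actual labellings, so the value is
attained whatever the treewidth (`exists_value_le_weight`). Conversely, if the neighbours of `C` lie
in one bag, then some bag contains them together with a vertex of `C` (`absorbing_bags`, by way of
`exists_gate`). These neighbours and this vertex are a legal next separator, and repeating this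
loses nothing (`weight_le_value`).

For fixed `t` there are polynomially many codes. `Evaluable` is a calculus of polynomial time
functions whose loops are bounded by register `1`. Values may be exponentially large, numbers of
rounds may not. The tables are filled by course-of-values recursion (`exists_fill`). -/

namespace ConnMaxCut

namespace RAM

/-! ## Functions of the memory that are evaluated in polynomial time -/

/-- `f` depends only on the arrays and the registers below `r`, and for every `s ≥ r` a program
computes it into register `s`, changing nothing but registers from `s` on, in time polynomial in
the content of register `1`, as long as this is `N` applied to the content of register `0`. -/
structure Evaluable (N : ℕ → ℕ) (r : ℕ) (f : State → ℕ) : Prop where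
  two_le : 2 ≤ r
  congr : ∀ σ τ : State, σ.reg 1 = N (σ.reg 0) → (∀ x < r, σ.reg x = τ.reg x) →
    σ.arr = τ.arr → f σ = f τ
  exec : ∀ s, r ≤ s → ∃ (P : Program) (p : Polynomial ℕ), ∀ σ : State, σ.reg 1 = N (σ.reg 0) →
    ∃ k τ, Exec P σ k τ ∧ k ≤ p.eval (σ.reg 1) ∧ τ.arr = σ.arr ∧ τ.reg s = f σ ∧
      ∀ x < s, τ.reg x = σ.reg x

/-- `f` is at most the content of register `1`. -/
def Bounded (N : ℕ → ℕ) (f : State → ℕ) : Prop :=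
  ∀ σ : State, σ.reg 1 = N (σ.reg 0) → f σ ≤ σ.reg 1

@[simp] theorem State.setReg_reg_self (σ : State) (x v : ℕ) : (σ.setReg x v).reg x = v := by
  simp [State.setReg]

theorem State.setReg_reg_of_ne (σ : State) {x y : ℕ} (v : ℕ) (h : y ≠ x) :
    (σ.setReg x v).reg y = σ.reg y := by
  simp [State.setReg, h]

@[simp] theorem State.setReg_arr (σ : State) (x v : ℕ) : (σ.setReg x v).arr = σ.arr := rfl

@[simp] theorem State.setArr_reg (σ : State) (a i v : ℕ) : (σ.setArr a i v).reg = σ.reg := rfl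

namespace Evaluable

variable {N : ℕ → ℕ} {r : ℕ}

theorem mono {f : State → ℕ} (hf : Evaluable N r f) {s : ℕ} (h : r ≤ s) : Evaluable N s f where
  two_le := hf.two_le.trans h
  congr σ τ h₀ h₁ h₂ := hf.congr σ τ h₀ (fun x hx => h₁ x (hx.trans_le h)) h₂
  exec s' hs' := hf.exec s' (h.trans hs')

/-- Evaluate `f` and `g` into consecutive registers and combine them by one expression. -/
theorem op {f g : State → ℕ} (hf : Evaluable N r f) (hg : Evaluable N r g)
    (F : (ℕ → ℕ → ℕ) → ℕ → ℕ → ℕ) (e : ℕ → Expr)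
    (he : ∀ s σ, (e s).eval σ = F σ.arr (σ.reg s) (σ.reg (s + 1))) :
    Evaluable N r (fun σ => F σ.arr (f σ) (g σ)) where
  two_le := hf.two_le
  congr σ τ h₀ h₁ h₂ := by rw [hf.congr σ τ h₀ h₁ h₂, hg.congr σ τ h₀ h₁ h₂, h₂]
  exec s hs := by
    obtain ⟨P, p, hP⟩ := hf.exec s hs
    obtain ⟨Q, q, hQ⟩ := hg.exec (s + 1) (by omega)
    have h2 := hf.two_le
    refine ⟨.seq P (.seq Q (.assign s (e s))), p + q + Polynomial.C ((e s).cost + 1),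
      fun σ hσ => ?_⟩
    obtain ⟨k, τ, hk, hkp, harr, hreg, hlt⟩ := hP σ hσ
    have h0 := hlt 0 (by omega)
    have h1 := hlt 1 (by omega)
    obtain ⟨k', τ', hk', hkp', harr', hreg', hlt'⟩ := hQ τ (by rw [h0, h1, hσ])
    refine ⟨_, _, .seq hk (.seq hk' (.assign _ _ _)), ?_, ?_, ?_, ?_⟩
    · simp only [Polynomial.eval_add, Polynomial.eval_C]
      rw [h1] at hkp'
      omega
    · simp [harr, harr']
    · rw [State.setReg_reg_self, he, hreg', hlt' s (by omega), hreg, harr', harr,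
        hg.congr τ σ (by rw [h0, h1, hσ]) (fun x hx => hlt x (by omega)) harr]
    · intro x hx
      rw [State.setReg_reg_of_ne _ _ hx.ne, hlt' x (by omega), hlt x hx]

theorem lit (hr : 2 ≤ r) (c : ℕ) : Evaluable N r (fun _ => c) where
  two_le := hr
  congr _ _ _ _ _ := rfl
  exec s _ := ⟨.assign s (.lit c), Polynomial.C 2, fun σ _ =>
    ⟨_, _, .assign _ _ _, by simp [Expr.cost], rfl, by simp [Expr.eval],
      fun x hx => State.setReg_reg_of_ne _ _ hx.ne⟩⟩

theorem reg (hr : 2 ≤ r) {x : ℕ} (hx : x < r) : Evaluable N r (fun σ => σ.reg x) where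
  two_le := hr
  congr _ _ _ h _ := h x hx
  exec s _ := ⟨.assign s (.reg x), Polynomial.C 2, fun σ _ =>
    ⟨_, _, .assign _ _ _, by simp [Expr.cost], rfl, by simp [Expr.eval],
      fun x hx => State.setReg_reg_of_ne _ _ hx.ne⟩⟩

theorem add {f g : State → ℕ} (hf : Evaluable N r f) (hg : Evaluable N r g) :
    Evaluable N r (fun σ => f σ + g σ) :=
  op hf hg (fun _ x y => x + y) (fun s => .add (.reg s) (.reg (s + 1))) fun _ _ => rfl

theorem sub {f g : State → ℕ} (hf : Evaluable N r f) (hg : Evaluable N r g) :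
    Evaluable N r (fun σ => f σ - g σ) :=
  op hf hg (fun _ x y => x - y) (fun s => .sub (.reg s) (.reg (s + 1))) fun _ _ => rfl

theorem arr {f : State → ℕ} (a : ℕ) (hf : Evaluable N r f) :
    Evaluable N r (fun σ => σ.arr a (f σ)) :=
  op hf hf (fun A x _ => A a x) (fun s => .arr a (.reg s)) fun _ _ => rfl

theorem cond {f g h : State → ℕ} (hf : Evaluable N r f) (hg : Evaluable N r g)
    (hh : Evaluable N r h) : Evaluable N r (fun σ => if f σ ≠ 0 then g σ else h σ) where
  two_le := hf.two_le
  congr σ τ h₀ h₁ h₂ := by rw [hf.congr σ τ h₀ h₁ h₂, hg.congr σ τ h₀ h₁ h₂, hh.congr σ τ h₀ h₁ h₂]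
  exec s hs := by
    obtain ⟨P, p, hP⟩ := hf.exec s hs
    obtain ⟨Q, q, hQ⟩ := hg.exec s hs
    obtain ⟨R, w, hR⟩ := hh.exec s hs
    have h2 := hf.two_le
    refine ⟨.seq P (.branch (.reg s) Q R), p + q + w + Polynomial.C 2, fun σ hσ => ?_⟩
    obtain ⟨k, τ, hk, hkp, harr, hreg, hlt⟩ := hP σ hσ
    have h0 := hlt 0 (by omega)
    have h1 := hlt 1 (by omega)
    by_cases hc : f σ = 0
    · obtain ⟨k', τ', hk', hkp', harr', hreg', hlt'⟩ := hR τ (by rw [h0, h1, hσ])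
      refine ⟨_, _, .seq hk (.branch_false (hreg.trans hc) hk'), ?_, harr'.trans harr, ?_, ?_⟩
      · simp only [Polynomial.eval_add, Polynomial.eval_C, Expr.cost]
        rw [h1] at hkp'
        omega
      · rw [hreg', hh.congr τ σ (by rw [h0, h1, hσ]) (fun x hx => hlt x (by omega)) harr]
        simp [hc]
      · exact fun x hx => (hlt' x hx).trans (hlt x hx)
    · obtain ⟨k', τ', hk', hkp', harr', hreg', hlt'⟩ := hQ τ (by rw [h0, h1, hσ])
      refine ⟨_, _, .seq hk (.branch_true (by simpa [Expr.eval, hreg] using hc) hk'), ?_,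
        harr'.trans harr, ?_, ?_⟩
      · simp only [Polynomial.eval_add, Polynomial.eval_C, Expr.cost]
        rw [h1] at hkp'
        omega
      · rw [hreg', hg.congr τ σ (by rw [h0, h1, hσ]) (fun x hx => hlt x (by omega)) harr]
        simp [hc]
      · exact fun x hx => (hlt' x hx).trans (hlt x hx)

end Evaluable

/-- A counting loop: if every run of the body in a memory satisfying the invariant `I i` takes at
most `c` steps and leads to `I (i + 1)`, then the loop leads from `I i` to `I h`. -/
theorem exec_loop (e : Expr) (P : Program) (I : ℕ → State → Prop) (h c : ℕ)
    (he : ∀ i ≤ h, ∀ σ, I i σ → e.eval σ = h - i)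
    (hP : ∀ i < h, ∀ σ, I i σ → ∃ k τ, Exec P σ k τ ∧ k ≤ c ∧ I (i + 1) τ) :
    ∀ m i, i + m = h → ∀ σ, I i σ → ∃ k τ, Exec (.loop e P) σ k τ ∧
      k ≤ m * (e.cost + 1 + c) + (e.cost + 1) ∧ I h τ := by
  intro m
  induction m with
  | zero =>
    intro i hi σ hσ
    obtain rfl : i = h := by omega
    exact ⟨_, _, .loop_done (by rw [he i le_rfl σ hσ]; omega), by omega, hσ⟩
  | succ m ih =>
    intro i hi σ hσ
    obtain ⟨k, τ, hk, hkc, hτ⟩ := hP i (by omega) σ hσ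
    obtain ⟨k', τ', hk', hkc', hτ'⟩ := ih (i + 1) (by omega) τ hτ
    refine ⟨_, _, .loop_step (by rw [he i (by omega) σ hσ]; omega) hk hk', ?_, hτ'⟩
    rw [add_mul]
    omega

namespace Evaluable

variable {N : ℕ → ℕ} {r : ℕ}

/-- The body is an operation on evaluable functions, so that index and accumulator may sit in
whatever registers are free. Only the number of rounds has to be bounded, not the accumulator. -/
theorem fold {f h : State → ℕ} {g : State → ℕ → ℕ → ℕ} (hh : Evaluable N r h)
    (hb : Bounded N h) (hf : Evaluable N r f)
    (hg : ∀ s, r ≤ s → ∀ i a, Evaluable N s i → Bounded N i → Evaluable N s a →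
      Evaluable N s (fun σ => g σ (i σ) (a σ))) :
    Evaluable N r (fun σ => Nat.rec (f σ) (g σ) (h σ)) := by
  have h2 := hf.two_le
  have hgc : ∀ σ τ : State, σ.reg 1 = N (σ.reg 0) → (∀ x < r, σ.reg x = τ.reg x) →
      σ.arr = τ.arr → ∀ i a, i ≤ σ.reg 1 → g σ i a = g τ i a := by
    intro σ τ h₀ h₁ h₂ i a hi
    -- `i - (i - x)` is `min i x`. The truncation makes the index bounded in every memory and is
    -- harmless where `i ≤ x`.
    have := (hg r le_rfl (fun ρ => i - (i - ρ.reg 1)) (fun _ => a)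
      ((lit h2 i).sub ((lit h2 i).sub (reg h2 (by omega)))) (fun ρ _ => by dsimp only; omega)
      (lit h2 a)).congr σ τ h₀ h₁ h₂
    simpa [← h₁ 1 (by omega), Nat.sub_eq_zero_of_le hi] using this
  refine ⟨h2, ?_, ?_⟩
  · intro σ τ h₀ h₁ h₂
    rw [← hh.congr σ τ h₀ h₁ h₂, ← hf.congr σ τ h₀ h₁ h₂]
    have key : ∀ m ≤ σ.reg 1, (Nat.rec (f σ) (g σ) m : ℕ) = Nat.rec (f σ) (g τ) m := by
      intro m
      induction m with
      | zero => intro _; rfl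
      | succ m ih =>
        intro hm
        have := ih (by omega)
        simp only [this, hgc σ τ h₀ h₁ h₂ m _ (by omega : m ≤ σ.reg 1)]
    exact key _ (hb σ h₀)
  · intro s hs
    obtain ⟨P, p, hP⟩ := hf.exec s hs
    obtain ⟨Q, q, hQ⟩ := hh.exec (s + 1) (by omega)
    have hs2 : 2 ≤ s + 3 := by omega
    obtain ⟨R, w, hR⟩ := (hg (s + 3) (by omega)
      (fun ρ => ρ.reg (s + 2) - (ρ.reg (s + 2) - ρ.reg 1)) (fun ρ => ρ.reg s)
      ((reg hs2 (by omega)).sub ((reg hs2 (by omega)).sub (reg hs2 (by omega))))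
      (fun ρ _ => by dsimp only; omega) (reg hs2 (by omega))).exec (s + 3) le_rfl
    -- Register `s` is the accumulator, `s + 1` the number of rounds, `s + 2` the counter. The body
    -- computes into `s + 3` and leaves these three alone.
    refine ⟨.seq P (.seq Q (.seq (.assign (s + 2) (.lit 0))
      (.loop (.sub (.reg (s + 1)) (.reg (s + 2)))
        (.seq R (.seq (.assign s (.reg (s + 3)))
          (.assign (s + 2) (.add (.reg (s + 2)) (.lit 1)))))))),
      p + q + Polynomial.C 2 + (Polynomial.X * (Polynomial.C 4 + (w + Polynomial.C 6)) +
        Polynomial.C 4), fun σ hσ => ?_⟩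
    obtain ⟨k₁, σ₁, hk₁, hkp₁, harr₁, hreg₁, hlt₁⟩ := hP σ hσ
    have h10 := hlt₁ 0 (by omega)
    have h11 := hlt₁ 1 (by omega)
    obtain ⟨k₂, σ₂, hk₂, hkp₂, harr₂, hreg₂, hlt₂⟩ := hQ σ₁ (by rw [h10, h11, hσ])
    rw [h11] at hkp₂
    have hh₂ : σ₂.reg (s + 1) = h σ := by
      rw [hreg₂, hh.congr σ σ₁ hσ (fun x hx => (hlt₁ x (by omega)).symm) harr₁.symm]
    let I : ℕ → State → Prop := fun i ρ => ρ.arr = σ.arr ∧ (∀ x < s, ρ.reg x = σ.reg x) ∧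
      ρ.reg s = Nat.rec (f σ) (g σ) i ∧ ρ.reg (s + 1) = h σ ∧ ρ.reg (s + 2) = i
    have hI₀ : I 0 (σ₂.setReg (s + 2) 0) := by
      refine ⟨by simp [harr₁, harr₂], fun x hx => ?_, ?_, ?_, by simp⟩
      · rw [State.setReg_reg_of_ne _ _ (by omega), hlt₂ x (by omega), hlt₁ x hx]
      · rw [State.setReg_reg_of_ne _ _ (by omega), hlt₂ s (by omega), hreg₁]; rfl
      · rw [State.setReg_reg_of_ne _ _ (by omega), hh₂]
    obtain ⟨k₃, σ₃, hk₃, hkp₃, hI⟩ := exec_loop (.sub (.reg (s + 1)) (.reg (s + 2)))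
      (.seq R (.seq (.assign s (.reg (s + 3)))
          (.assign (s + 2) (.add (.reg (s + 2)) (.lit 1))))) I (h σ)
      (w.eval (σ.reg 1) + 6) (fun i _ ρ hρ => by
        simp only [Expr.eval]; rw [hρ.2.2.2.1, hρ.2.2.2.2]) (fun i hi ρ hρ => by
        obtain ⟨ha, hx, hs', h1, h2'⟩ := hρ
        have e0 := hx 0 (by omega)
        have e1 := hx 1 (by omega)
        obtain ⟨k, τ, hk, hkp, harr, hreg, hlt⟩ := hR ρ (by rw [e0, e1, hσ])
        refine ⟨_, _, .seq hk (.seq (.assign _ _ _) (.assign _ _ _)), ?_, ?_, ?_, ?_, ?_, ?_⟩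
        · rw [e1] at hkp
          simp only [Expr.cost]
          omega
        · simp [harr, ha]
        · intro x hxs
          rw [State.setReg_reg_of_ne _ _ (by omega), State.setReg_reg_of_ne _ _ (by omega),
            hlt x (by omega), hx x hxs]
        · rw [State.setReg_reg_of_ne _ _ (by omega), State.setReg_reg_self]
          simp only [Expr.eval]
          rw [hreg, h2', e1, hs']
          have hiN := hb σ hσ
          rw [Nat.sub_eq_zero_of_le (by omega : i ≤ σ.reg 1), Nat.sub_zero,
            ← hgc σ ρ hσ (fun x hx' => (hx x (by omega)).symm) ha.symm _ _ (by omega)]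
        · rw [State.setReg_reg_of_ne _ _ (by omega), State.setReg_reg_of_ne _ _ (by omega),
            hlt _ (by omega), h1]
        · rw [State.setReg_reg_self]
          simp only [Expr.eval]
          rw [State.setReg_reg_of_ne _ _ (by omega), hlt _ (by omega), h2'])
      (h σ) 0 (by omega) _ hI₀
    refine ⟨_, _, .seq hk₁ (.seq hk₂ (.seq (.assign _ _ _) hk₃)), ?_, hI.1, hI.2.2.1, hI.2.1⟩
    simp only [Polynomial.eval_add, Polynomial.eval_C, Polynomial.eval_mul, Polynomial.eval_X,
      Expr.cost] at hkp₃ ⊢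
    have := Nat.mul_le_mul_right (4 + (w.eval (σ.reg 1) + 6)) (hb σ hσ)
    norm_num at hkp₃ ⊢
    omega

end Evaluable

theorem Bounded.mono {N : ℕ → ℕ} {f g : State → ℕ} (hg : Bounded N g) (h : ∀ σ, f σ ≤ g σ) :
    Bounded N f := fun σ hσ => (h σ).trans (hg σ hσ)

namespace Evaluable

variable {N : ℕ → ℕ} {r : ℕ} {f h : State → ℕ} {g : State → ℕ → ℕ}

theorem sum (hh : Evaluable N r h) (hb : Bounded N h)
    (hg : ∀ s, r ≤ s → ∀ i, Evaluable N s i → Bounded N i → Evaluable N s (fun σ => g σ (i σ))) :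
    Evaluable N r (fun σ => ∑ i ∈ Finset.range (h σ), g σ i) := by
  convert fold (g := fun σ i a => a + g σ i) hh hb (lit hh.two_le 0)
    (fun s hs i a hi hib ha => ha.add (hg s hs i hi hib)) using 2 with σ
  induction h σ with
  | zero => rfl
  | succ m ih => rw [Finset.sum_range_succ, ih]

theorem sup (hh : Evaluable N r h) (hb : Bounded N h)
    (hg : ∀ s, r ≤ s → ∀ i, Evaluable N s i → Bounded N i → Evaluable N s (fun σ => g σ (i σ))) :
    Evaluable N r (fun σ => (Finset.range (h σ)).sup (g σ)) := by
  -- With truncated subtraction, `a + (x - a)` is the maximum of `a` and `x`.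
  convert fold (g := fun σ i a => a + (g σ i - a)) hh hb (lit hh.two_le 0)
    (fun s hs i a hi hib ha => ha.add ((hg s hs i hi hib).sub ha)) using 2 with σ
  induction h σ with
  | zero => rfl
  | succ m ih =>
    rw [Finset.range_add_one, Finset.sup_insert, ih]
    change max (g σ m) (Nat.rec 0 (fun i a => a + (g σ i - a)) m : ℕ) =
      (Nat.rec 0 (fun i a => a + (g σ i - a)) m : ℕ) +
        (g σ m - Nat.rec 0 (fun i a => a + (g σ i - a)) m)
    omega

/-- Repeated addition: only the factor that counts the rounds is bounded, the other may be
exponentially large. -/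
theorem mul {f g : State → ℕ} (hf : Evaluable N r f) (hb : Bounded N f) (hg : Evaluable N r g) :
    Evaluable N r (fun σ => f σ * g σ) := by
  convert sum hf hb (g := fun σ _ => g σ) (fun s hs _ _ _ => hg.mono hs) using 2
  simp

theorem pow (hf : Evaluable N r f) (hb : Bounded N f) (k : ℕ) :
    Evaluable N r (fun σ => f σ ^ k) := by
  induction k with
  | zero => simpa using lit hf.two_le 1
  | succ k ih => simpa [pow_succ'] using hf.mul hb ih

/-- Repeated doubling. The value need not be bounded, which admits the exponential weights. -/
theorem two_pow (hf : Evaluable N r f) (hb : Bounded N f) :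
    Evaluable N r (fun σ => 2 ^ f σ) := by
  convert fold (g := fun σ i a => a + a) hf hb (lit hf.two_le 1)
    (fun s hs i a hi hib ha => ha.add ha) using 2 with σ
  induction f σ with
  | zero => rfl
  | succ m ih => rw [pow_succ, ih]; simp only; omega

end Evaluable

/-! ### Predicates decided in polynomial time -/

open Classical in
/-- The truth value of `p` is evaluated in polynomial time. -/
def Testable (N : ℕ → ℕ) (r : ℕ) (p : State → Prop) : Prop :=
  Evaluable N r (fun σ => if p σ then 1 else 0)

variable {N : ℕ → ℕ} {r : ℕ}

theorem Evaluable.ite {p : State → Prop} {f g : State → ℕ} {inst : ∀ σ, Decidable (p σ)}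
    (hp : Testable N r p) (hf : Evaluable N r f) (hg : Evaluable N r g) :
    Evaluable N r (fun σ => if p σ then f σ else g σ) := by
  convert Evaluable.cond hp hf hg using 2 with σ
  by_cases h : p σ <;> simp [h]

theorem Evaluable.testable {p : State → Prop} {f : State → ℕ} (hf : Evaluable N r f)
    (h : ∀ σ, p σ ↔ f σ ≠ 0) : Testable N r p := by
  have := hf.cond (.lit hf.two_le 1) (.lit hf.two_le 0)
  unfold Testable
  convert this using 3
  exact h _

namespace Testable

variable {p q : State → Prop}

theorem two_le (hp : Testable N r p) : 2 ≤ r := Evaluable.two_le hp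

theorem not (hp : Testable N r p) : Testable N r (fun σ => ¬ p σ) :=
  (Evaluable.ite (inst := fun _ => Classical.dec _) hp (.lit hp.two_le 0)
    (.lit hp.two_le 1)).testable
    fun σ => by by_cases h : p σ <;> simp [h]

theorem and (hp : Testable N r p) (hq : Testable N r q) : Testable N r (fun σ => p σ ∧ q σ) :=
  (Evaluable.ite (inst := fun _ => Classical.dec _) hp hq (.lit hp.two_le 0)).testable
    fun σ => by by_cases h : p σ <;> simp [h]

theorem or (hp : Testable N r p) (hq : Testable N r q) : Testable N r (fun σ => p σ ∨ q σ) :=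
  (Evaluable.ite (inst := fun _ => Classical.dec _) hp (.lit hp.two_le 1) hq).testable
    fun σ => by by_cases h : p σ <;> simp [h]

theorem imp (hp : Testable N r p) (hq : Testable N r q) : Testable N r (fun σ => p σ → q σ) := by
  simpa only [imp_iff_not_or] using hp.not.or hq

theorem lt {f g : State → ℕ} (hf : Evaluable N r f) (hg : Evaluable N r g) :
    Testable N r (fun σ => f σ < g σ) :=
  (hg.sub hf).testable fun σ => by omega

theorem le {f g : State → ℕ} (hf : Evaluable N r f) (hg : Evaluable N r g) :
    Testable N r (fun σ => f σ ≤ g σ) := by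
  simpa using (lt hg hf).not

theorem eq {f g : State → ℕ} (hf : Evaluable N r f) (hg : Evaluable N r g) :
    Testable N r (fun σ => f σ = g σ) := by
  simpa [le_antisymm_iff] using (le hf hg).and (le hg hf)

theorem exists_lt {h : State → ℕ} {p : State → ℕ → Prop} (hh : Evaluable N r h)
    (hb : Bounded N h)
    (hp : ∀ s, r ≤ s → ∀ i, Evaluable N s i → Bounded N i → Testable N s (fun σ => p σ (i σ))) :
    Testable N r (fun σ => ∃ i < h σ, p σ i) := by
  classical
  exact (Evaluable.sum (g := fun σ i => if p σ i then 1 else 0) hh hb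
    fun s hs i hi hib => Evaluable.ite (hp s hs i hi hib) (.lit (hp s hs i hi hib).two_le 1)
      (.lit (hp s hs i hi hib).two_le 0)).testable fun σ => by simp

theorem forall_lt {h : State → ℕ} {p : State → ℕ → Prop} (hh : Evaluable N r h)
    (hb : Bounded N h)
    (hp : ∀ s, r ≤ s → ∀ i, Evaluable N s i → Bounded N i → Testable N s (fun σ => p σ (i σ))) :
    Testable N r (fun σ => ∀ i < h σ, p σ i) := by
  simpa using (exists_lt (p := fun σ i => ¬ p σ i) hh hb
    fun s hs i hi hib => (hp s hs i hi hib).not).not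

end Testable

namespace Evaluable

variable {f g : State → ℕ}

/-- The quotient counts the `i` with `(i + 1) * g ≤ f`. The dividend bounds this count, so it must
not be exponentially large. The test `0 < g` reproduces division by zero. -/
theorem div (hf : Evaluable N r f) (hb : Bounded N f) (hg : Evaluable N r g) :
    Evaluable N r (fun σ => f σ / g σ) := by
  classical
  convert sum (g := fun σ i => if 0 < g σ ∧ i * g σ + g σ ≤ f σ then 1 else 0) hf hb
    (fun s hs i hi hib => .ite ((Testable.lt (lit hi.two_le 0) (hg.mono hs)).and
      (.le ((hi.mul hib (hg.mono hs)).add (hg.mono hs)) (hf.mono hs)))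
      (lit hi.two_le 1) (lit hi.two_le 0)) using 2 with σ
  rcases Nat.eq_zero_or_pos (g σ) with h | h
  · simp [h]
  · rw [← Finset.card_filter]
    have : {i ∈ Finset.range (f σ) | 0 < g σ ∧ i * g σ + g σ ≤ f σ} = Finset.range (f σ / g σ) := by
      ext i
      rw [Finset.mem_filter, Finset.mem_range, Finset.mem_range,
        ← Nat.add_one_le_iff (n := i) (m := f σ / g σ),
        Nat.le_div_iff_mul_le h, add_mul, one_mul]
      refine ⟨fun h' => h'.2.2, fun h' => ⟨?_, h, h'⟩⟩
      have := Nat.le_mul_of_pos_right i h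
      omega
    rw [this, Finset.card_range]

theorem mod (hf : Evaluable N r f) (hb : Bounded N f) (hg : Evaluable N r g) :
    Evaluable N r (fun σ => f σ % g σ) := by
  have := hf.sub ((hf.div hb hg).mul (hb.mono fun σ => Nat.div_le_self _ _) hg)
  convert this using 2 with σ
  rw [Nat.mod_eq_sub_div_mul]

end Evaluable

/-- Filling an array by course-of-values recursion: the value `f` of cell `i` is computed with `i`
in register `2`. -/
theorem exists_fill {N : ℕ → ℕ} (a : ℕ) {f : State → ℕ} (hf : Evaluable N 3 f)
    (hloc : ∀ σ τ : State, σ.reg = τ.reg → (∀ b ≠ a, σ.arr b = τ.arr b) →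
      (∀ i < σ.reg 2, σ.arr a i = τ.arr a i) → f σ = f τ) :
    ∃ (P : Program) (p : Polynomial ℕ), ∀ σ : State, σ.reg 1 = N (σ.reg 0) →
      ∃ k τ, Exec P σ k τ ∧ k ≤ p.eval (σ.reg 1) ∧ τ.reg 0 = σ.reg 0 ∧ τ.reg 1 = σ.reg 1 ∧
        (∀ b ≠ a, τ.arr b = σ.arr b) ∧ ∀ i < σ.reg 1, τ.arr a i = f (τ.setReg 2 i) := by
  obtain ⟨R, w, hR⟩ := hf.exec 3 le_rfl
  refine ⟨.seq (.assign 2 (.lit 0)) (.loop (.sub (.reg 1) (.reg 2))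
    (.seq R (.seq (.store a (.reg 2) (.reg 3)) (.assign 2 (.add (.reg 2) (.lit 1)))))),
    Polynomial.C 2 + (Polynomial.X * (Polynomial.C 4 + (w + Polynomial.C 7)) + Polynomial.C 4),
    fun σ hσ => ?_⟩
  let I : ℕ → State → Prop := fun i ρ => ρ.reg 0 = σ.reg 0 ∧ ρ.reg 1 = σ.reg 1 ∧ ρ.reg 2 = i ∧
    (∀ b ≠ a, ρ.arr b = σ.arr b) ∧ ∀ j < i, ρ.arr a j = f (ρ.setReg 2 j)
  have hcongr : ∀ (ρ τ : State) (j : ℕ), ρ.reg 0 = σ.reg 0 → ρ.reg 1 = σ.reg 1 →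
      τ.reg 0 = σ.reg 0 → τ.reg 1 = σ.reg 1 → (∀ b ≠ a, ρ.arr b = τ.arr b) →
      (∀ i < j, ρ.arr a i = τ.arr a i) → f (ρ.setReg 2 j) = f (τ.setReg 2 j) := by
    intro ρ τ j h0 h1 h0' h1' hb ha
    -- Two stages: `hloc` exchanges the arrays with the registers fixed, then `hf.congr` exchanges
    -- the registers with the arrays fixed.
    have e1 : f (ρ.setReg 2 j) = f ⟨(ρ.setReg 2 j).reg, τ.arr⟩ :=
      hloc _ _ rfl hb (by simpa using ha)
    rw [e1]
    refine hf.congr _ _ ?_ (fun x hx => ?_) rfl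
    · change (ρ.setReg 2 j).reg 1 = N ((ρ.setReg 2 j).reg 0)
      simp [State.setReg, h0, h1, hσ]
    · interval_cases x <;> simp [State.setReg, h0, h1, h0', h1']
  obtain ⟨k, τ, hk, hkp, hI⟩ := exec_loop (.sub (.reg 1) (.reg 2))
    (.seq R (.seq (.store a (.reg 2) (.reg 3)) (.assign 2 (.add (.reg 2) (.lit 1))))) I (σ.reg 1)
    (w.eval (σ.reg 1) + 7) (fun i _ ρ hρ => by
      simp only [Expr.eval]; rw [hρ.2.1, hρ.2.2.1]) (fun i hi ρ hρ => by
      obtain ⟨h0, h1, h2, hb, ha⟩ := hρ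
      obtain ⟨k, τ, hk, hkp, harr, hreg, hlt⟩ := hR ρ (by rw [h0, h1, hσ])
      have t0 := hlt 0 (by omega)
      have t1 := hlt 1 (by omega)
      have t2 := hlt 2 (by omega)
      have hρi : ρ.setReg 2 i = ρ := by
        ext x
        · by_cases hx : x = 2
          · subst hx; simp [h2]
          · rw [State.setReg_reg_of_ne _ _ hx]
        · rfl
      refine ⟨_, _, .seq hk (.seq (.store _ _ _ _) (.assign _ _ _)), ?_, ?_, ?_, ?_, ?_, ?_⟩
      · rw [h1] at hkp
        simp only [Expr.cost]
        omega
      · rw [State.setReg_reg_of_ne _ _ (by omega), State.setArr_reg, t0, h0]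
      · rw [State.setReg_reg_of_ne _ _ (by omega), State.setArr_reg, t1, h1]
      · simp [Expr.eval, t2, h2]
      · intro b hb'
        simp only [State.setReg_arr, State.setArr, Function.update_of_ne hb']
        rw [harr, hb b hb']
      · have hv : ∀ j, ((τ.setArr a (Expr.eval τ (.reg 2)) (Expr.eval τ (.reg 3)))).arr a j =
            if j = i then f ρ else ρ.arr a j := by
          intro j
          simp only [State.setArr, Function.update_self, Expr.eval, t2, h2, hreg, harr]
          rw [Function.update_apply]
        intro j hj
        rw [State.setReg_arr, hv]
        -- Writing cell `i` keeps the equations of all cells `j' ≤ i` valid, since these read array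
        -- `a` only below `j'`.
        have key : ∀ j' ≤ i, f (ρ.setReg 2 j') = f (((τ.setArr a (Expr.eval τ (.reg 2))
            (Expr.eval τ (.reg 3))).setReg 2 (Expr.eval (τ.setArr a (Expr.eval τ (.reg 2))
            (Expr.eval τ (.reg 3))) (.add (.reg 2) (.lit 1)))).setReg 2 j') := by
          intro j' hj'
          refine hcongr _ _ j' h0 h1 ?_ ?_ ?_ ?_
          · rw [State.setReg_reg_of_ne _ _ (by omega), State.setArr_reg, t0, h0]
          · rw [State.setReg_reg_of_ne _ _ (by omega), State.setArr_reg, t1, h1]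
          · intro b hb'
            simp only [State.setReg_arr, State.setArr, Function.update_of_ne hb']
            rw [harr]
          · intro l hl
            rw [State.setReg_arr, hv, if_neg (by omega)]
        rw [← key j (by omega)]
        split_ifs with hji
        · rw [hji, hρi]
        · exact ha j (by omega))
    (σ.reg 1) 0 (by omega) (σ.setReg 2 0) (by
      refine ⟨?_, ?_, by simp, fun _ _ => rfl, by simp⟩ <;>
        rw [State.setReg_reg_of_ne _ _ (by omega)])
  refine ⟨_, _, .seq (.assign _ _ _) hk, ?_, hI.1, hI.2.1, hI.2.2.2.1, hI.2.2.2.2⟩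
  simp only [Polynomial.eval_add, Polynomial.eval_C, Polynomial.eval_mul, Polynomial.eval_X,
    Expr.cost] at hkp ⊢
  norm_num at hkp ⊢
  omega

end RAM

/-! ## The dynamic program

The vertices are the numbers below `n`, and `A` is the adjacency relation. Put `b = n + 2`. A
literal is a number `e`, which assigns the label `e % b ^ 2` to the vertex `e / b ^ 2`. A number `q`
encodes the set of the at most `k` literals `e` such that `e + 1` is among the first `k` digits
of `q` in base `b ^ 3`. -/

section Definitions

variable (b n : ℕ) (A : ℕ → ℕ → Prop)

/-- The literal `e` is one of the first `k` literals encoded by `q`. -/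
def HasLit : ℕ → ℕ → ℕ → Prop
  | 0, _, _ => False
  | k + 1, q, e => q % b ^ 3 = e + 1 ∨ HasLit k (q / b ^ 3) e

/-- Some literal encoded by `q` concerns the vertex `u`. -/
def Occurs (k q u : ℕ) : Prop :=
  ∃ e < b ^ 3, HasLit b k q e ∧ e / b ^ 2 = u

/-- `u` lies in the connected component of `c` after the deletion of `X`. -/
def Comp (X : ℕ → Prop) (c u : ℕ) : Prop :=
  (c < n ∧ ¬ X c) ∧ Relation.ReflTransGen (fun x y => A x y ∧ ¬ X y) c u

/-- The first literal encoded by `q`. -/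
def headLit (q : ℕ) : ℕ := q % b ^ 3 - 1

/-- `q'` may follow `q` at the component `C q c`: its first literal concerns a vertex of the
component, the others are in `q`, and their vertices separate the component from the rest. -/
def Follows (k : ℕ) (C : ℕ → ℕ → ℕ → Prop) (q c q' : ℕ) : Prop :=
  q' % b ^ 3 ≠ 0 ∧ C q c (headLit b q' / b ^ 2) ∧
    (∀ e < b ^ 3, HasLit b k q' e → e = headLit b q' ∨ HasLit b k q e) ∧
    ∀ x < n, C q c x → ∀ y < n, A x y → C q c y ∨ Occurs b k q' y

open Classical in
/-- The weight of the pairs formed by the first literal of `q` and a literal of `q`. -/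
noncomputable def headWeight (k : ℕ) (W : ℕ → ℕ → ℕ) (q : ℕ) : ℕ :=
  ∑ e ∈ Finset.range (b ^ 3), if HasLit b k q e then
    if e / b ^ 2 = headLit b q / b ^ 2 then W (headLit b q) (headLit b q)
    else W (headLit b q) e + W e (headLit b q)
  else 0

open Classical in
/-- One step of the dynamic program. -/
noncomputable def step (k : ℕ) (C : ℕ → ℕ → ℕ → Prop) (W : ℕ → ℕ → ℕ) (T : ℕ → ℕ → ℕ)
    (q c : ℕ) : ℕ :=
  (Finset.range (b ^ (3 * k))).sup fun q' => if Follows b n A k C q c q' then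
    headWeight b k W q' + ∑ c' ∈ Finset.range n,
      if (C q c c' ∧ c' ≠ headLit b q' / b ^ 2) ∧ ∀ u < c', ¬ C q' c' u then T q' c' else 0
  else 0

/-- The value of the dynamic program after `s` steps. -/
noncomputable def value (k : ℕ) (W : ℕ → ℕ → ℕ) : ℕ → ℕ → ℕ → ℕ
  | 0 => fun _ _ => 0
  | s + 1 => step b n A k (fun q => Comp n A (Occurs b k q)) W (value k W s)

open Classical in
/-- The total weight of the pairs of vertices that meet `C` under the labelling `f`, which maps
each vertex to a literal of it. -/
noncomputable def weight (W : ℕ → ℕ → ℕ) (C : ℕ → Prop) (f : ℕ → ℕ) : ℕ :=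
  ∑ u ∈ Finset.range n, ∑ v ∈ Finset.range n, if C u ∨ C v then W (f u) (f v) else 0

end Definitions

/-! ### Components after the deletion of a set of vertices -/

section Components

variable {n : ℕ} {A : ℕ → ℕ → Prop} {X : ℕ → Prop}

namespace Comp

theorem refl {c : ℕ} (hc : c < n) (hX : ¬ X c) : Comp n A X c c := ⟨⟨hc, hX⟩, .refl⟩

theorem step {c u v : ℕ} (h : Comp n A X c u) (ha : A u v) (hv : ¬ X v) : Comp n A X c v :=
  ⟨h.1, h.2.tail ⟨ha, hv⟩⟩

theorem notMem {c u : ℕ} (h : Comp n A X c u) : ¬ X u := by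
  rcases h.2.cases_tail with h' | ⟨_, _, h'⟩
  · exact h' ▸ h.1.2
  · exact h'.2

variable (hlt : ∀ u v, A u v → u < n ∧ v < n) (hsymm : ∀ u v, A u v → A v u)

include hlt in
theorem lt {c u : ℕ} (h : Comp n A X c u) : u < n := by
  rcases h.2.cases_tail with h' | ⟨_, _, h'⟩
  · exact h' ▸ h.1.1
  · exact (hlt _ _ h'.1).2

theorem trans {c u v : ℕ} (h : Comp n A X c u) (h' : Comp n A X u v) : Comp n A X c v :=
  ⟨h.1, h.2.trans h'.2⟩

include hlt hsymm in
theorem symm {c u : ℕ} (h : Comp n A X c u) : Comp n A X u c := by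
  obtain ⟨hc, h⟩ := h
  induction h with
  | refl => exact ⟨hc, .refl⟩
  | @tail x y hx hxy ih =>
    exact trans (step ⟨⟨(hlt _ _ hxy.1).2, hxy.2⟩, .refl⟩ (hsymm _ _ hxy.1) (notMem ⟨hc, hx⟩)) ih

end Comp

variable (hlt : ∀ u v, A u v → u < n ∧ v < n) (hsymm : ∀ u v, A u v → A v u)

-- The least vertex of a component serves as its name, which turns sums over components into sums
-- over vertices.
include hlt hsymm in
theorem exists_least {u : ℕ} (hu : u < n) (hX : ¬ X u) :
    ∃ c, Comp n A X c u ∧ ∀ v < c, ¬ Comp n A X c v := by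
  classical
  have hex : ∃ c, Comp n A X u c := ⟨u, .refl hu hX⟩
  have h := Nat.find_spec hex
  exact ⟨Nat.find hex, h.symm hlt hsymm, fun v hv hcv => Nat.find_min hex hv (h.trans hcv)⟩

include hlt hsymm in
theorem least_unique {c c' u : ℕ} (h : Comp n A X c u) (hl : ∀ v < c, ¬ Comp n A X c v)
    (h' : Comp n A X c' u) (hl' : ∀ v < c', ¬ Comp n A X c' v) : c = c' := by
  have h1 := h.trans (h'.symm hlt hsymm)
  have h2 := h1.symm hlt hsymm
  rcases lt_trichotomy c c' with h | h | h
  · exact absurd h2 (hl' _ h)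
  · exact h
  · exact absurd h1 (hl _ h)

end Components

/-! ### Splitting the weight of a labelling along separators -/

section Weight

variable {b n : ℕ} {A : ℕ → ℕ → Prop} {X : ℕ → Prop} {W : ℕ → ℕ → ℕ}
  (hlt : ∀ u v, A u v → u < n ∧ v < n) (hsymm : ∀ u v, A u v → A v u)
  (hW : ∀ e e', W e e' ≠ 0 → e / b ^ 2 = e' / b ^ 2 ∨ A (e / b ^ 2) (e' / b ^ 2))

include hW in
theorem adj_of_weight_ne_zero {f : ℕ → ℕ} (hf : ∀ u, f u / b ^ 2 = u) {u v : ℕ}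
    (h : W (f u) (f v) ≠ 0) : u = v ∨ A u v := by
  simpa [hf] using hW _ _ h

include hsymm hW in
/-- The weight at `C` depends only on the labels of `C` and of its neighbours. -/
theorem weight_congr {C : ℕ → Prop} (hC : ∀ u v, C u → A u v → C v ∨ X v) {f g : ℕ → ℕ}
    (hf : ∀ u, f u / b ^ 2 = u) (hg : ∀ u, g u / b ^ 2 = u) (hfg : ∀ u, C u ∨ X u → f u = g u) :
    weight n W C f = weight n W C g := by
  refine Finset.sum_congr rfl fun u _ => Finset.sum_congr rfl fun v _ => ?_
  split_ifs with h
  · by_cases huv : u = v ∨ A u v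
    · have hu : C u ∨ X u := by
        rcases huv with rfl | huv
        · tauto
        · rcases h with h | h
          · exact .inl h
          · exact hC _ _ h (hsymm _ _ huv)
      have hv : C v ∨ X v := by
        rcases huv with rfl | huv
        · tauto
        · rcases h with h | h
          · exact hC _ _ h huv
          · exact .inl h
      rw [hfg u hu, hfg v hv]
    · have h1 : W (f u) (f v) = 0 := by
        by_contra h0; exact huv (adj_of_weight_ne_zero hW hf h0)
      have h2 : W (g u) (g v) = 0 := by
        by_contra h0; exact huv (adj_of_weight_ne_zero hW hg h0)
      rw [h1, h2]
  · rfl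

include hlt hsymm hW in
open Classical in
/-- The weight at a union of components is the sum of their weights. -/
theorem weight_eq_sum {U : ℕ → Prop} (hU : ∀ u, U u → u < n ∧ ¬ X u)
    (hcl : ∀ u v, U u → A u v → ¬ X v → U v) {f : ℕ → ℕ} (hf : ∀ u, f u / b ^ 2 = u) :
    weight n W U f = ∑ c ∈ Finset.range n,
      if U c ∧ ∀ u < c, ¬ Comp n A X c u then weight n W (Comp n A X c) f else 0 := by
  have hUC : ∀ c u, U c → Comp n A X c u → U u := by
    rintro c u hc ⟨_, h⟩
    induction h with
    | refl => exact hc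
    | tail _ h ih => exact hcl _ _ ih h.1 h.2
  have e1 : ∀ c ∈ Finset.range n,
      (if U c ∧ ∀ u < c, ¬ Comp n A X c u then weight n W (Comp n A X c) f else 0) =
      ∑ u ∈ Finset.range n, ∑ v ∈ Finset.range n,
        if (U c ∧ ∀ u < c, ¬ Comp n A X c u) ∧ (Comp n A X c u ∨ Comp n A X c v)
        then W (f u) (f v) else 0 := by
    intro c _
    by_cases hc : U c ∧ ∀ u < c, ¬ Comp n A X c u
    · simp only [if_pos hc, weight, and_iff_right hc]
    · simp [hc]
  rw [Finset.sum_congr rfl e1, Finset.sum_comm]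
  refine Finset.sum_congr rfl fun u _ => ?_
  rw [Finset.sum_comm]
  refine Finset.sum_congr rfl fun v _ => ?_
  by_cases h0 : W (f u) (f v) = 0
  · simp [h0]
  have huv := adj_of_weight_ne_zero hW hf h0
  split_ifs with h
  · obtain ⟨x, hx, hxu⟩ : ∃ x, U x ∧ ∀ c, U c →
        ((Comp n A X c u ∨ Comp n A X c v) ↔ Comp n A X c x) := by
      rcases huv with rfl | huv
      · exact ⟨u, by tauto, by tauto⟩
      · rcases h with h | h
        · exact ⟨u, h, fun c _ => ⟨fun h' => h'.elim id
            fun h' => h'.step (hsymm _ _ huv) (hU u h).2, .inl⟩⟩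
        · exact ⟨v, h, fun c _ => ⟨fun h' => h'.elim (fun h' => h'.step huv (hU v h).2) id, .inr⟩⟩
    obtain ⟨c, hc, hcl'⟩ := exists_least hlt hsymm (hU x hx).1 (hU x hx).2
    have hUc : U c := hUC _ _ hx (hc.symm hlt hsymm)
    rw [Finset.sum_eq_single c]
    · rw [if_pos ⟨⟨hUc, hcl'⟩, (hxu c hUc).2 hc⟩]
    · rintro c' _ hne
      rw [if_neg]
      rintro ⟨⟨h1, h2⟩, h3⟩
      exact hne (least_unique hlt hsymm ((hxu c' h1).1 h3) h2 hc hcl')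
    · intro hn
      exact absurd (Finset.mem_range.2 hc.1.1) hn
  · symm
    apply Finset.sum_eq_zero
    intro c _
    rw [if_neg]
    rintro ⟨⟨h1, -⟩, h2 | h2⟩
    · exact h (.inl (hUC _ _ h1 h2))
    · exact h (.inr (hUC _ _ h1 h2))

include hlt hsymm hW in
open Classical in
/-- Labellings that are good at each of several components can be combined. -/
theorem exists_glue {U : ℕ → Prop} (hU : ∀ u, U u → u < n ∧ ¬ X u)
    (hcl : ∀ u v, U u → A u v → ¬ X v → U v) {f : ℕ → ℕ} (hf : ∀ u, f u / b ^ 2 = u)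
    (T : ℕ → ℕ)
    (hT : ∀ c, ∃ g : ℕ → ℕ, (∀ u, g u / b ^ 2 = u) ∧ (∀ u, ¬ Comp n A X c u → g u = f u) ∧
      T c ≤ weight n W (Comp n A X c) g) :
    ∃ g : ℕ → ℕ, (∀ u, g u / b ^ 2 = u) ∧ (∀ u, ¬ U u → g u = f u) ∧
      (∑ c ∈ Finset.range n, if U c ∧ ∀ u < c, ¬ Comp n A X c u then T c else 0) ≤
        weight n W U g := by
  choose F hFv hFo hFT using hT
  have hrep : ∀ u, ∃ c, U u → Comp n A X c u ∧ ∀ v < c, ¬ Comp n A X c v := by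
    intro u
    by_cases h : U u
    · obtain ⟨c, hc⟩ := exists_least hlt hsymm (hU u h).1 (hU u h).2
      exact ⟨c, fun _ => hc⟩
    · exact ⟨0, fun h' => absurd h' h⟩
  choose rep hrep using hrep
  have hUC : ∀ c u, U c → Comp n A X c u → U u := by
    rintro c u hc ⟨_, h⟩
    induction h with
    | refl => exact hc
    | tail _ h ih => exact hcl _ _ ih h.1 h.2
  have hg : ∀ u, (if U u then F (rep u) u else f u) / b ^ 2 = u := by
    intro u
    split_ifs
    · exact hFv _ _
    · exact hf _
  refine ⟨fun u => if U u then F (rep u) u else f u, hg, fun u hu => if_neg hu, ?_⟩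
  rw [weight_eq_sum hlt hsymm hW hU hcl hg]
  refine Finset.sum_le_sum fun c _ => ?_
  split_ifs with hc
  · refine (hFT c).trans (le_of_eq ?_)
    -- The weight at a component sees only the component and `X`. On the component the glued
    -- labelling is `F c`, and on `X` both labellings are `f`.
    refine weight_congr (X := X) hsymm hW (fun u v hu huv => ?_) (hFv c) hg fun u hu => ?_
    · by_cases hv : X v
      · exact .inr hv
      · exact .inl (hu.step huv hv)
    · rcases hu with hu | hu
      · have hUu := hUC _ _ hc.1 hu
        rw [if_pos hUu, least_unique hlt hsymm (hrep u hUu).1 (hrep u hUu).2 hu hc.2]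
      · rw [if_neg fun h => (hU u h).2 hu, hFo c u fun h => h.notMem hu]
  · exact le_rfl

include hsymm hW in
open Classical in
/-- Splitting off the pairs that contain the vertex `v` and a vertex of a separator. -/
theorem weight_eq_add {C : ℕ → Prop} {v : ℕ} (hvn : v < n) (hv : C v) (hXv : X v)
    (hC : ∀ u w, C u → A u w → C w ∨ X w) (hCX : ∀ u, C u → X u → u = v)
    {f : ℕ → ℕ} (hf : ∀ u, f u / b ^ 2 = u) :
    weight n W C f = (∑ u ∈ Finset.range n, if X u then
      (if u = v then W (f v) (f v) else W (f v) (f u) + W (f u) (f v)) else 0) +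
      weight n W (fun u => C u ∧ u ≠ v) f := by
  -- The identity holds pair by pair. A pair of nonzero weight that meets `C` only in `v` consists
  -- of `v` and a vertex of `X`; a pair of `v` with another vertex of `C` belongs to the last
  -- summand alone. The test `x ≠ v` keeps `(v, v)` from being counted twice.
  have key : ∀ x y, (if C x ∨ C y then W (f x) (f y) else 0) =
      ((if x = v then (if X y then W (f v) (f y) else 0) else 0) +
      (if y = v then (if x ≠ v ∧ X x then W (f x) (f v) else 0) else 0)) +
      (if (C x ∧ x ≠ v) ∨ (C y ∧ y ≠ v) then W (f x) (f y) else 0) := by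
    intro x y
    by_cases h0 : W (f x) (f y) = 0
    · by_cases hx : x = v
      · subst hx
        by_cases hy : y = x
        · subst hy; simp [h0]
        · simp [h0, hy]
      · by_cases hy : y = v
        · subst hy; simp [h0, hx]
        · simp [h0, hx, hy]
    have hxy := adj_of_weight_ne_zero hW hf h0
    by_cases hx : x = v
    · subst hx
      by_cases hy : y = x
      · subst hy; simp [hv, hXv]
      · have hA : A x y := by
          rcases hxy with h | h
          · exact absurd h.symm hy
          · exact h
        have := hC x y hv hA
        have := hCX y
        by_cases hCy : C y
        · have : ¬ X y := fun h => hy (hCX y hCy h)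
          simp [hv, hCy, hy, this]
        · have : X y := by tauto
          simp [hv, hCy, hy, this]
    · by_cases hy : y = v
      · subst hy
        have hA : A x y := by
          rcases hxy with h | h
          · exact absurd h hx
          · exact h
        have := hC y x hv (hsymm _ _ hA)
        by_cases hCx : C x
        · have : ¬ X x := fun h => hx (hCX x hCx h)
          simp [hv, hCx, hx, this]
        · have : X x := by tauto
          simp [hv, hCx, hx, this]
      · simp [hx, hy]
  unfold weight
  simp_rw [key, Finset.sum_add_distrib]
  refine congrArg₂ (· + ·) ?_ (by congr!)
  have h1 : ∑ x ∈ Finset.range n, ∑ y ∈ Finset.range n,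
      (if x = v then (if X y then W (f v) (f y) else 0) else 0) =
      ∑ y ∈ Finset.range n, if X y then W (f v) (f y) else 0 := by
    rw [Finset.sum_eq_single v]
    · simp
    · intro x _ hx; simp [hx]
    · intro h; exact absurd (Finset.mem_range.2 hvn) h
  have h2 : ∑ x ∈ Finset.range n, ∑ y ∈ Finset.range n,
      (if y = v then (if x ≠ v ∧ X x then W (f x) (f v) else 0) else 0) =
      ∑ x ∈ Finset.range n, if x ≠ v ∧ X x then W (f x) (f v) else 0 := by
    refine Finset.sum_congr rfl fun x _ => ?_
    rw [Finset.sum_eq_single v]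
    · simp
    · intro x _ hx; simp [hx]
    · intro h; exact absurd (Finset.mem_range.2 hvn) h
  rw [h1, h2, ← Finset.sum_add_distrib]
  refine Finset.sum_congr rfl fun u _ => ?_
  by_cases hX : X u <;> by_cases hu : u = v <;> simp [hX, hu]

end Weight

/-! ### Lists of literals as numbers -/

section Codes

variable {b : ℕ}

theorem HasLit.lt (hb : 0 < b) {e : ℕ} : ∀ {k q : ℕ}, HasLit b k q e → e < b ^ 3
  | k + 1, q, h => by
    rcases h with h | h
    · have := Nat.mod_lt q (Nat.pow_pos (n := 3) hb)
      omega
    · exact h.lt hb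

/-- The code of a list of literals. -/
def code (b : ℕ) : List ℕ → ℕ
  | [] => 0
  | e :: l => (e + 1) + b ^ 3 * code b l

theorem code_mod {e : ℕ} {l : List ℕ} (he : e + 1 < b ^ 3) :
    code b (e :: l) % b ^ 3 = e + 1 := by
  rw [code, Nat.add_mul_mod_self_left, Nat.mod_eq_of_lt he]

theorem code_div {e : ℕ} {l : List ℕ} (he : e + 1 < b ^ 3) :
    code b (e :: l) / b ^ 3 = code b l := by
  rw [code, Nat.add_mul_div_left _ _ (by omega), Nat.div_eq_of_lt he, zero_add]

theorem not_hasLit_zero (e : ℕ) : ∀ k, ¬ HasLit b k 0 e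
  | 0 => id
  | k + 1 => by
    rintro (h | h)
    · simp at h
    · rw [Nat.zero_div] at h
      exact not_hasLit_zero e k h

theorem hasLit_code {e : ℕ} : ∀ {k : ℕ} {l : List ℕ}, (∀ x ∈ l, x + 1 < b ^ 3) → l.length ≤ k →
    (HasLit b k (code b l) e ↔ e ∈ l)
  | k, [], _, _ => by simp [code, not_hasLit_zero]
  | k + 1, x :: l, hl, hk => by
    have hx := hl x (by simp)
    rw [HasLit, code_mod hx, code_div hx,
      hasLit_code (l := l) (fun y hy => hl y (List.mem_cons_of_mem _ hy)) (by simpa using hk)]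
    simp [eq_comm]

/-- For fixed `k` the codes are polynomially many, so loops and tables may range over all of them.
-/
theorem code_lt : ∀ {k : ℕ} {l : List ℕ}, (∀ x ∈ l, x + 1 < b ^ 3) → l.length ≤ k → 0 < b →
    code b l < b ^ (3 * k)
  | k, [], _, _, hb => Nat.pow_pos hb
  | k + 1, x :: l, hl, hk, hb => by
    have h1 := hl x (by simp)
    have h2 := code_lt (k := k) (l := l) (fun y hy => hl y (List.mem_cons_of_mem _ hy))
      (by simpa using hk) hb
    have h3 : b ^ 3 * (code b l + 1) ≤ b ^ 3 * b ^ (3 * k) := Nat.mul_le_mul_left _ h2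
    rw [code, mul_add 3, add_comm (3 * k), mul_one, pow_add]
    rw [mul_add] at h3
    omega

end Codes

/-! ### The dynamic program computes the maximum weight -/

section Correctness

variable {n : ℕ} {A : ℕ → ℕ → Prop} {W : ℕ → ℕ → ℕ} {k : ℕ}
  (hlt : ∀ u v, A u v → u < n ∧ v < n) (hsymm : ∀ u v, A u v → A v u)
  (hW : ∀ e e', W e e' ≠ 0 →
    e / (n + 2) ^ 2 = e' / (n + 2) ^ 2 ∨ A (e / (n + 2) ^ 2) (e' / (n + 2) ^ 2))

include hlt hW in
open Classical in
/-- The weight at the first literal is the weight of the pairs that the first vertex forms with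
the vertices of the code. -/
theorem headWeight_eq {q : ℕ} {f : ℕ → ℕ} (hf : ∀ u, f u / (n + 2) ^ 2 = u)
    (hq : ∀ e, HasLit (n + 2) k q e → f (e / (n + 2) ^ 2) = e)
    {v : ℕ} (hv : f v = headLit (n + 2) q) (hvn : v < n) :
    headWeight (n + 2) k W q = ∑ u ∈ Finset.range n, if Occurs (n + 2) k q u then
      (if u = v then W (f v) (f v) else W (f v) (f u) + W (f u) (f v)) else 0 := by
  have hvv : headLit (n + 2) q / (n + 2) ^ 2 = v := by rw [← hv, hf]
  have hocc : ∀ u, Occurs (n + 2) k q u ↔ HasLit (n + 2) k q (f u) := by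
    intro u
    constructor
    · rintro ⟨e, _, he, rfl⟩
      rwa [hq e he]
    · intro h
      exact ⟨f u, h.lt (by omega), h, hf u⟩
  let g : ℕ → ℕ := fun e => if e / (n + 2) ^ 2 = v then W (f v) (f v) else W (f v) e + W e (f v)
  -- A literal may concern a number that is not a vertex; it has no weight against `v`, since
  -- adjacency lives below `n`.
  have hg : ∀ e, g e ≠ 0 → e / (n + 2) ^ 2 < n := by
    intro e he
    by_cases h : e / (n + 2) ^ 2 = v
    · rwa [h]
    · simp only [g, if_neg h] at he
      by_cases h1 : W (f v) e = 0
      · have := hW e (f v) (by omega)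
        rw [hf] at this
        rcases this with h' | h'
        · exact absurd h' h
        · exact (hlt _ _ h').1
      · have := hW (f v) e h1
        rw [hf] at this
        rcases this with h' | h'
        · exact absurd h'.symm h
        · exact (hlt _ _ h').2
  have e1 : headWeight (n + 2) k W q =
      ∑ e ∈ Finset.range ((n + 2) ^ 3), ∑ u ∈ Finset.range n,
        if HasLit (n + 2) k q e ∧ e = f u then g e else 0 := by
    unfold headWeight
    refine Finset.sum_congr rfl fun e _ => ?_
    rw [hvv, ← hv]
    by_cases he : HasLit (n + 2) k q e
    · change (if HasLit (n + 2) k q e then g e else 0) = _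
      simp only [he, true_and, if_true]
      by_cases h0 : g e = 0
      · simp [h0]
      · rw [Finset.sum_eq_single (e / (n + 2) ^ 2)]
        · rw [if_pos (hq e he).symm]
        · intro u _ hu
          rw [if_neg]
          rintro rfl
          exact hu (hf u).symm
        · intro h
          exact absurd (Finset.mem_range.2 (hg e h0)) h
    · simp [he]
  rw [e1, Finset.sum_comm]
  refine Finset.sum_congr rfl fun u _ => ?_
  rw [hocc]
  split_ifs with h1 h2
  · rw [Finset.sum_eq_single (f u)]
    · simp [h1, ← h2, g, hf]
    · intro e _ he
      simp [he]
    · intro h; exact absurd (Finset.mem_range.2 (h1.lt (by omega))) h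
  · rw [Finset.sum_eq_single (f u)]
    · simp [h1, g, hf, h2]
    · intro e _ he
      simp [he]
    · intro h; exact absurd (Finset.mem_range.2 (h1.lt (by omega))) h
  · apply Finset.sum_eq_zero
    intro e _
    rw [if_neg]
    rintro ⟨h2, rfl⟩
    exact h1 h2

variable (k) in
/-- The component of `c` once the vertices of `q` are deleted. -/
abbrev component (n : ℕ) (A : ℕ → ℕ → Prop) (q : ℕ) : ℕ → ℕ → Prop :=
  Comp n A (Occurs (n + 2) k q)

theorem hasLit_headLit {b q : ℕ} (hk : 0 < k) (h : q % b ^ 3 ≠ 0) :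
    HasLit b k q (headLit b q) := by
  obtain ⟨k, rfl⟩ : ∃ l, k = l + 1 := ⟨k - 1, by omega⟩
  left
  change q % b ^ 3 = q % b ^ 3 - 1 + 1
  exact (Nat.succ_pred_eq_of_ne_zero h).symm

include hlt hsymm hW in
/-- The value of the dynamic program is attained by a labelling. -/
theorem exists_value_le_weight (hk : 0 < k) :
    ∀ (s q c : ℕ) (f : ℕ → ℕ), (∀ u, f u / (n + 2) ^ 2 = u) →
    (∀ e, HasLit (n + 2) k q e → f (e / (n + 2) ^ 2) = e) →
    ∃ g : ℕ → ℕ, (∀ u, g u / (n + 2) ^ 2 = u) ∧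
      (∀ u, ¬ component k n A q c u → g u = f u) ∧
      value (n + 2) n A k W s q c ≤ weight n W (component k n A q c) g
  | 0, q, c, f, hf, _ => ⟨f, hf, fun _ _ => rfl, Nat.zero_le _⟩
  | s + 1, q, c, f, hf, hq => by
    classical
    obtain ⟨q', -, hq'⟩ := Finset.exists_mem_eq_sup (Finset.range ((n + 2) ^ (3 * k)))
      ⟨0, by simp⟩ (fun q' => if Follows (n + 2) n A k (component k n A) q c q' then
        headWeight (n + 2) k W q' + ∑ c' ∈ Finset.range n,
          if (component k n A q c c' ∧ c' ≠ headLit (n + 2) q' / (n + 2) ^ 2) ∧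
            ∀ u < c', ¬ component k n A q' c' u then value (n + 2) n A k W s q' c' else 0
        else 0)
    have hval : value (n + 2) n A k W (s + 1) q c = _ := hq'
    rw [hval]
    split_ifs with hfol
    swap
    · exact ⟨f, hf, fun _ _ => rfl, Nat.zero_le _⟩
    obtain ⟨h0, hhead, hsub, hsep⟩ := hfol
    set h := headLit (n + 2) q' with hh
    set v := h / (n + 2) ^ 2 with hv
    have hvn : v < n := hhead.lt hlt
    have hlit : ∀ e, HasLit (n + 2) k q' e → e = h ∨ HasLit (n + 2) k q e :=
      fun e he => hsub e (he.lt (by omega)) he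
    -- The vertex `v` survives the deletion of the vertices of `q`, so relabelling it contradicts no
    -- literal of `q`.
    have hqv : ∀ e, HasLit (n + 2) k q e → e / (n + 2) ^ 2 ≠ v := fun e he hev =>
      hhead.notMem ⟨e, he.lt (by omega), he, hev⟩
    have hXq : ∀ u, component k n A q c u → Occurs (n + 2) k q' u → u = v := by
      rintro u hu ⟨e, he, hl, rfl⟩
      rcases hlit e hl with rfl | hl
      · rfl
      · exact absurd ⟨e, he, hl, rfl⟩ hu.notMem
    have hhl : HasLit (n + 2) k q' h := hasLit_headLit hk h0
    have hXv : Occurs (n + 2) k q' v := ⟨h, hhl.lt (by omega), hhl, rfl⟩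
    have hf' : ∀ u, Function.update f v h u / (n + 2) ^ 2 = u := by
      intro u
      by_cases hu : u = v
      · rw [hu, Function.update_self]
      · rw [Function.update_of_ne hu, hf]
    have hqf' : ∀ e, HasLit (n + 2) k q' e → Function.update f v h (e / (n + 2) ^ 2) = e := by
      intro e he
      by_cases hev : e = h
      · rw [hev, ← hv, Function.update_self]
      · have he' := (hlit e he).resolve_left hev
        rw [Function.update_of_ne (hqv e he'), hq e he']
    -- As the vertices of `q'` separate, the old component without `v` is a union of components for
    -- `q'`, and the induction hypothesis applies to each of them independently.
    obtain ⟨g, hg, hgo, hgs⟩ := exists_glue hlt hsymm hW (X := Occurs (n + 2) k q')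
      (U := fun u => component k n A q c u ∧ u ≠ v)
      (fun u hu => ⟨hu.1.lt hlt, fun hX => hu.2 (hXq u hu.1 hX)⟩)
      (fun x y hx hxy hy => ⟨(hsep x (hlt _ _ hxy).1 hx.1 y (hlt _ _ hxy).2 hxy).resolve_right hy,
        fun hyv => hy (hyv ▸ hXv)⟩) hf' (fun c' => value (n + 2) n A k W s q' c')
      (fun c' => exists_value_le_weight hk s q' c' _ hf' hqf')
    have hgX : ∀ u, Occurs (n + 2) k q' u → g u = Function.update f v h u :=
      fun u hu => hgo u fun h' => h'.2 (hXq u h'.1 hu)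
    refine ⟨g, hg, fun u hu => ?_, ?_⟩
    · have huv : u ≠ v := fun huv => hu (huv ▸ hhead)
      rw [hgo u fun h' => hu h'.1, Function.update_of_ne huv]
    · rw [weight_eq_add hsymm hW (X := Occurs (n + 2) k q') hvn hhead hXv
        (fun x y hx hxy => hsep x (hlt _ _ hxy).1 hx y (hlt _ _ hxy).2 hxy) hXq hg]
      refine add_le_add (le_of_eq ?_) (le_trans (le_of_eq (by congr!)) hgs)
      rw [headWeight_eq hlt hW hg (fun e he => ?_) (v := v) ?_ hvn]
      · rw [hgX v hXv, Function.update_self]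
      · rw [hgX _ ⟨e, he.lt (by omega), he, rfl⟩, hqf' e he]

/-- Every component whose neighbours lie in one member of the family `F` contains a vertex that
lies in a common member of `F` with all these neighbours. -/
def Absorbing (n : ℕ) (A : ℕ → ℕ → Prop) (F : Set (Finset ℕ)) : Prop :=
  ∀ (X : ℕ → Prop) (c : ℕ), c < n → ¬ X c → ∀ B ∈ F,
    (∀ x y, Comp n A X c x → A x y → Comp n A X c y ∨ y ∈ B) →
    ∃ v, ∃ B' ∈ F, Comp n A X c v ∧ v ∈ B' ∧
      ∀ x y, Comp n A X c x → A x y → Comp n A X c y ∨ y ∈ B'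

include hlt hsymm hW in
open Classical in
/-- If the graph has an absorbing family of sets of size at most `k`, then no labelling has a larger
weight than the value of the dynamic program. -/
theorem weight_le_value (hk : 0 < k) {F : Set (Finset ℕ)} (hF : Absorbing n A F)
    (hFk : ∀ B ∈ F, B.card ≤ k) {f : ℕ → ℕ} (hf : ∀ u, f u / (n + 2) ^ 2 = u) :
    ∀ (s q c : ℕ), (∀ e, HasLit (n + 2) k q e → f (e / (n + 2) ^ 2) = e) → c < n →
      ¬ Occurs (n + 2) k q c → ((Finset.range n).filter (component k n A q c)).card ≤ s →
      ∀ B ∈ F, (∀ x y, component k n A q c x → A x y → component k n A q c y ∨ y ∈ B) →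
      weight n W (component k n A q c) f ≤ value (n + 2) n A k W s q c
  | 0, q, c, hq, hc, hX, hs, B, hB, hBC => by
    exfalso
    have : c ∈ (Finset.range n).filter (component k n A q c) :=
      Finset.mem_filter.2 ⟨Finset.mem_range.2 hc, .refl hc hX⟩
    rw [Finset.card_eq_zero.1 (Nat.le_zero.1 hs)] at this
    exact absurd this (Finset.notMem_empty c)
  | s + 1, q, c, hq, hc, hX, hs, B, hB, hBC => by
    obtain ⟨v, B', hB', hCv, hvB', hsep⟩ := hF _ c hc hX B hB hBC
    have hvn := hCv.lt hlt
    have hfb : ∀ u < n, f u + 1 < (n + 2) ^ 3 := by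
      intro u hu
      have h1 : f u < (u + 1) * (n + 2) ^ 2 :=
        Nat.lt_mul_of_div_lt (by rw [hf]; omega) (by positivity)
      have h2 : (u + 1) * (n + 2) ^ 2 ≤ n * (n + 2) ^ 2 := Nat.mul_le_mul_right _ hu
      have h3 : (n + 2) ^ 3 = n * (n + 2) ^ 2 + (n + 2) ^ 2 * 2 := by ring
      have h4 : 0 < (n + 2) ^ 2 := by positivity
      omega
    -- The neighbourhood of the component, which together with `v` is the next separator. It lies in
    -- `B'` without `v`, so `k` literals are enough.
    let S : Finset ℕ := (Finset.range n).filter fun y =>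
      ¬ component k n A q c y ∧ ∃ x, component k n A q c x ∧ A x y
    have hS : ∀ y, y ∈ S ↔ ¬ component k n A q c y ∧ ∃ x, component k n A q c x ∧ A x y := by
      intro y
      simp only [S, Finset.mem_filter, Finset.mem_range]
      refine ⟨fun h => h.2, fun h => ⟨?_, h⟩⟩
      obtain ⟨-, x, -, hxy⟩ := h
      exact (hlt _ _ hxy).2
    have hSB : S ⊆ B'.erase v := by
      intro y hy
      obtain ⟨h1, x, hx, hxy⟩ := (hS y).1 hy
      exact Finset.mem_erase.2 ⟨fun h => h1 (h ▸ hCv), (hsep x y hx hxy).resolve_left h1⟩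
    have hSX : ∀ y ∈ S, Occurs (n + 2) k q y := by
      intro y hy
      obtain ⟨h1, x, hx, hxy⟩ := (hS y).1 hy
      by_contra h2
      exact h1 (hx.step hxy h2)
    let l : List ℕ := f v :: S.toList.map f
    have hmem : ∀ e, e ∈ l ↔ e = f v ∨ ∃ y ∈ S, f y = e := by
      intro e; simp [l]
    have hl1 : ∀ e ∈ l, e + 1 < (n + 2) ^ 3 := by
      intro e he
      rcases (hmem e).1 he with rfl | ⟨y, hy, rfl⟩
      · exact hfb v hvn
      · exact hfb y (Finset.mem_range.1 (Finset.mem_filter.1 hy).1)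
    have hl2 : l.length ≤ k := by
      have h1 := Finset.card_le_card hSB
      have h2 := Finset.card_erase_add_one hvB'
      have h3 := hFk B' hB'
      simp only [l, List.length_cons, List.length_map, Finset.length_toList]
      omega
    have hlit : ∀ e, HasLit (n + 2) k (code (n + 2) l) e ↔ e = f v ∨ ∃ y ∈ S, f y = e :=
      fun e => (hasLit_code hl1 hl2).trans (hmem e)
    have hhead : headLit (n + 2) (code (n + 2) l) = f v := by
      rw [headLit, code_mod (hfb v hvn), Nat.add_sub_cancel]
    have hocc : ∀ u, Occurs (n + 2) k (code (n + 2) l) u ↔ u = v ∨ u ∈ S := by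
      intro u
      constructor
      · rintro ⟨e, -, he, rfl⟩
        rcases (hlit e).1 he with rfl | ⟨y, hy, rfl⟩
        · exact .inl (hf v)
        · rw [hf]; exact .inr hy
      · intro h
        have : HasLit (n + 2) k (code (n + 2) l) (f u) := (hlit _).2 (by
          rcases h with rfl | h
          · exact .inl rfl
          · exact .inr ⟨u, h, rfl⟩)
        exact ⟨f u, this.lt (by omega), this, hf u⟩
    have hql : ∀ e, HasLit (n + 2) k (code (n + 2) l) e → f (e / (n + 2) ^ 2) = e := by
      intro e he
      rcases (hlit e).1 he with rfl | ⟨y, hy, rfl⟩ <;> rw [hf]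
    have hfol : Follows (n + 2) n A k (component k n A) q c (code (n + 2) l) := by
      refine ⟨?_, ?_, ?_, ?_⟩
      · rw [code_mod (hfb v hvn)]; omega
      · rwa [hhead, hf]
      · intro e _ he
        rw [hhead]
        rcases (hlit e).1 he with rfl | ⟨y, hy, rfl⟩
        · exact .inl rfl
        · right
          obtain ⟨e, he, hqe, rfl⟩ := hSX y hy
          rwa [hq e hqe]
      · intro x _ hx y _ hxy
        by_cases h : component k n A q c y
        · exact .inl h
        · exact .inr ((hocc y).2 (.inr ((hS y).2 ⟨h, x, hx, hxy⟩)))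
    have hsep' : ∀ x y, component k n A q c x → A x y →
        component k n A q c y ∨ Occurs (n + 2) k (code (n + 2) l) y :=
      fun x y hx hxy => hfol.2.2.2 x (hlt _ _ hxy).1 hx y (hlt _ _ hxy).2 hxy
    have hXv : Occurs (n + 2) k (code (n + 2) l) v := (hocc v).2 (.inl rfl)
    have hCX : ∀ u, component k n A q c u → Occurs (n + 2) k (code (n + 2) l) u → u = v := by
      intro u hu h
      exact ((hocc u).1 h).resolve_right fun h => ((hS u).1 h).1 hu
    have hcl : ∀ x y, component k n A q c x ∧ x ≠ v → A x y →
        ¬ Occurs (n + 2) k (code (n + 2) l) y → component k n A q c y ∧ y ≠ v :=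
      fun x y hx hxy hy => ⟨(hsep' x y hx.1 hxy).resolve_right hy, fun h => hy (h ▸ hXv)⟩
    have hle := Finset.le_sup (f := fun q' => if Follows (n + 2) n A k (component k n A) q c q' then
        headWeight (n + 2) k W q' + ∑ c' ∈ Finset.range n,
          if (component k n A q c c' ∧ c' ≠ headLit (n + 2) q' / (n + 2) ^ 2) ∧
            ∀ u < c', ¬ component k n A q' c' u then value (n + 2) n A k W s q' c' else 0
        else 0) (Finset.mem_range.2 (code_lt hl1 hl2 (by omega : 0 < n + 2)))
    refine le_trans ?_ hle
    beta_reduce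
    rw [if_pos hfol, weight_eq_add hsymm hW hvn hCv hXv hsep' hCX hf,
      headWeight_eq hlt hW hf hql hhead.symm hvn,
      weight_eq_sum hlt hsymm hW (X := Occurs (n + 2) k (code (n + 2) l))
        (fun u hu => ⟨hu.1.lt hlt, fun h => hu.2 (hCX u hu.1 h)⟩) hcl hf, hhead, hf]
    refine add_le_add le_rfl (Finset.sum_le_sum fun c' hc' => ?_)
    by_cases h : (component k n A q c c' ∧ c' ≠ v) ∧
      ∀ u < c', ¬ component k n A (code (n + 2) l) c' u
    · rw [if_pos h, if_pos h]
      have hc'X : ¬ Occurs (n + 2) k (code (n + 2) l) c' := fun h' => h.1.2 (hCX _ h.1.1 h')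
      refine weight_le_value hk hF hFk hf s _ c' hql (Finset.mem_range.1 hc') hc'X ?_ B' hB' ?_
      -- The new component has lost `v`, which pays for the step used.
      · have hsub : (Finset.range n).filter (component k n A (code (n + 2) l) c') ⊂
            (Finset.range n).filter (component k n A q c) := by
          rw [Finset.ssubset_iff_of_subset]
          · refine ⟨v, Finset.mem_filter.2 ⟨Finset.mem_range.2 hvn, hCv⟩, fun hv => ?_⟩
            exact (Finset.mem_filter.1 hv).2.notMem hXv
          · intro u hu
            obtain ⟨hu1, -, hu2⟩ := Finset.mem_filter.1 hu
            refine Finset.mem_filter.2 ⟨hu1, ?_⟩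
            clear hu hu1
            suffices component k n A q c u ∧ u ≠ v from this.1
            induction hu2 with
            | refl => exact h.1
            | tail _ h ih => exact hcl _ _ ih h.1 h.2
        have := Finset.card_lt_card hsub
        omega
      · intro x y hx hxy
        by_cases hy : Occurs (n + 2) k (code (n + 2) l) y
        · right
          rcases (hocc y).1 hy with rfl | hy
          · exact hvB'
          · exact Finset.mem_of_mem_erase (hSB hy)
        · exact .inl (hx.step hxy hy)
    · rw [if_neg h]
      exact Nat.zero_le _

open Classical in
/-- The final value of the dynamic program: the sum over all components of the graph. -/
noncomputable def total (n : ℕ) (C : ℕ → ℕ → ℕ → Prop) (T : ℕ → ℕ → ℕ) : ℕ :=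
  ∑ c ∈ Finset.range n, if ∀ u < c, ¬ C 0 c u then T 0 c else 0

theorem not_occurs_zero (b k u : ℕ) : ¬ Occurs b k 0 u := by
  rintro ⟨e, -, he, -⟩
  exact not_hasLit_zero e k he

-- The code `0` has no literals, so nothing is deleted at the start and any initial labelling is
-- consistent with it.
include hlt hsymm hW in
theorem exists_total_le_weight (hk : 0 < k) (s : ℕ) : ∃ f : ℕ → ℕ, (∀ u, f u / (n + 2) ^ 2 = u) ∧
    total n (component k n A) (value (n + 2) n A k W s) ≤ weight n W (· < n) f := by
  classical
  obtain ⟨g, hg, -, h⟩ := exists_glue hlt hsymm hW (X := Occurs (n + 2) k 0) (U := (· < n))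
    (fun u hu => ⟨hu, not_occurs_zero _ _ _⟩) (fun u v _ huv _ => (hlt _ _ huv).2)
    (f := fun u => u * (n + 2) ^ 2) (fun u => Nat.mul_div_cancel u (by positivity))
    (value (n + 2) n A k W s 0)
    (fun c => exists_value_le_weight hlt hsymm hW hk s 0 c _
      (fun u => Nat.mul_div_cancel u (by positivity)) fun e he => absurd he (not_hasLit_zero _ _))
  refine ⟨g, hg, le_trans (Finset.sum_le_sum fun c hc => ?_) h⟩
  rw [Finset.mem_range] at hc
  simp only [hc, true_and]
  exact le_rfl

-- No component has more than `n` vertices, so `n` steps suffice. Any member of `F` can start the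
-- descent, because a component of the whole graph has no neighbours outside.
include hlt hsymm hW in
theorem weight_le_total (hk : 0 < k) {F : Set (Finset ℕ)} (hF : Absorbing n A F)
    (hFn : F.Nonempty) (hFk : ∀ B ∈ F, B.card ≤ k) {f : ℕ → ℕ}
    (hf : ∀ u, f u / (n + 2) ^ 2 = u) :
    weight n W (· < n) f ≤ total n (component k n A) (value (n + 2) n A k W n) := by
  classical
  obtain ⟨B, hB⟩ := hFn
  rw [weight_eq_sum hlt hsymm hW (X := Occurs (n + 2) k 0) (U := (· < n))
    (fun u hu => ⟨hu, not_occurs_zero _ _ _⟩) (fun u v _ huv _ => (hlt _ _ huv).2) hf]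
  refine Finset.sum_le_sum fun c hc => ?_
  rw [Finset.mem_range] at hc
  by_cases h : ∀ u < c, ¬ component k n A 0 c u
  · rw [if_pos ⟨hc, h⟩, if_pos h]
    refine weight_le_value hlt hsymm hW hk hF hFk hf n 0 c
      (fun e he => absurd he (not_hasLit_zero _ _)) hc (not_occurs_zero _ _ _)
      ((Finset.card_filter_le _ _).trans (Finset.card_range n).le) B hB
      fun x y hx hxy => .inl (hx.step hxy (not_occurs_zero _ _ _))
  · rw [if_neg fun h' => h h'.2]
    exact Nat.zero_le _

end Correctness

/-! ## Bags of tree decompositions -/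

section Tree

variable {ι : Type*} {T : SimpleGraph ι}

/-- `i` and `j` are joined by a path of `T` inside `H`. -/
def JoinedIn (T : SimpleGraph ι) (H : Set ι) : ι → ι → Prop :=
  Relation.ReflTransGen fun i j => T.Adj i j ∧ i ∈ H ∧ j ∈ H

theorem joinedIn_of_connected {H : Set ι} (h : (T.induce H).Connected) {i j : ι} (hi : i ∈ H)
    (hj : j ∈ H) : JoinedIn T H i j := by
  have := (SimpleGraph.reachable_iff_reflTransGen _ _).1 (h.preconnected ⟨i, hi⟩ ⟨j, hj⟩)
  exact this.lift Subtype.val fun a b hab => ⟨hab, a.2, b.2⟩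

theorem JoinedIn.mono {H K : Set ι} (hHK : H ⊆ K) {i j : ι} (h : JoinedIn T H i j) :
    JoinedIn T K i j :=
  Relation.ReflTransGen.mono (fun _ _ h => ⟨h.1, hHK h.2.1, hHK h.2.2⟩) _ _ h

/-- A path inside `H` survives the deletion of an edge that is not inside `H`. -/
theorem JoinedIn.reachable {H : Set ι} {i j a b : ι} (h : JoinedIn T H i j)
    (hab : ¬ (a ∈ H ∧ b ∈ H)) : (T.deleteEdges {s(a, b)}).Reachable i j := by
  rw [SimpleGraph.reachable_iff_reflTransGen]
  refine Relation.ReflTransGen.mono (fun x y h => ?_) _ _ h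
  rw [SimpleGraph.deleteEdges_adj]
  refine ⟨h.1, fun h' => hab ?_⟩
  rw [Set.mem_singleton_iff, Sym2.eq_iff] at h'
  rcases h' with ⟨rfl, rfl⟩ | ⟨rfl, rfl⟩
  · exact h.2
  · exact h.2.symm

/-- A walk into `D` enters it through some edge. -/
theorem exists_entering {D : Set ι} {j l : ι} (p : T.Walk j l) (hl : l ∈ D) (hj : j ∉ D) :
    ∃ a b, T.Adj a b ∧ a ∉ D ∧ b ∈ D ∧ JoinedIn T Dᶜ j a := by
  induction p with
  | nil => exact absurd hl hj
  | @cons u v w h p ih =>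
    by_cases hv : v ∈ D
    · exact ⟨u, v, h, hj, hv, .refl⟩
    · obtain ⟨a, b, hab, ha, hb, hva⟩ := ih hl hv
      exact ⟨a, b, hab, ha, hb, .head ⟨h, hj, hv⟩ hva⟩

/-- In a tree, for a connected `D` there is a node of `D` that lies in every connected set which
meets `D` and contains `j`. -/
theorem exists_gate (hT : T.IsTree) {D : Set ι} (hD : ∀ i ∈ D, ∀ l ∈ D, JoinedIn T D i l)
    (hne : D.Nonempty) (j : ι) :
    ∃ i ∈ D, ∀ H : Set ι, (T.induce H).Connected → j ∈ H → (D ∩ H).Nonempty → i ∈ H := by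
  by_cases hj : j ∈ D
  · exact ⟨j, hj, fun _ _ h _ => h⟩
  obtain ⟨l, hl⟩ := hne
  obtain ⟨p⟩ := hT.1.preconnected j l
  -- The gate is the end `b` of an edge through which a walk from `j` enters `D`.
  obtain ⟨a, b, hab, ha, hb, hja⟩ := exists_entering p hl hj
  refine ⟨b, hb, fun H hH hjH ⟨l', hlD, hlH⟩ => ?_⟩
  by_contra hbH
  -- If `H` missed `b`, then `a` and `b` would be joined without the edge `ab`: from `a` to `j`
  -- outside `D`, on to `l'` inside `H`, and to `b` inside `D`. But edges of a tree are bridges.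
  have hbridge := SimpleGraph.isAcyclic_iff_forall_adj_isBridge.1 hT.2 hab
  rw [SimpleGraph.isBridge_iff] at hbridge
  have h1 := hja.reachable (a := a) (b := b) fun h => h.2 hb
  have h2 := (joinedIn_of_connected hH hjH hlH).reachable (a := a) (b := b) fun h => hbH h.2
  have h3 := (hD l' hlD b hb).reachable (a := a) (b := b) fun h => ha h.1
  exact hbridge ((h1.symm.trans h2).trans h3)

end Tree

/-- Adjacency in `G` as a relation on the natural numbers. -/
def NatAdj {n : ℕ} (G : SimpleGraph (Fin n)) (u v : ℕ) : Prop :=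
  ∃ (hu : u < n) (hv : v < n), G.Adj ⟨u, hu⟩ ⟨v, hv⟩

theorem NatAdj.lt {n : ℕ} (G : SimpleGraph (Fin n)) (u v : ℕ) (h : NatAdj G u v) : u < n ∧ v < n :=
  ⟨h.1, h.2.1⟩

theorem NatAdj.symm {n : ℕ} (G : SimpleGraph (Fin n)) (u v : ℕ) (h : NatAdj G u v) :
    NatAdj G v u :=
  ⟨h.2.1, h.1, h.2.2.symm⟩

/-- The bags of a tree decomposition absorb components. -/
theorem absorbing_bags {n : ℕ} {G : SimpleGraph (Fin n)} {ι : Type*} {T : SimpleGraph ι}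
    {bag : ι → Finset (Fin n)} (h : IsTreeDecomposition G T bag) :
    Absorbing n (NatAdj G) (Set.range fun i => (bag i).map Fin.valEmbedding) := by
  rintro X c hc hX _ ⟨j, rfl⟩ hB
  have hlt := NatAdj.lt G
  have hmem : ∀ i u (hu : u < n), u ∈ (bag i).map Fin.valEmbedding ↔ (⟨u, hu⟩ : Fin n) ∈ bag i := by
    intro i u hu
    simp only [Finset.mem_map, Fin.valEmbedding_apply]
    constructor
    · rintro ⟨v, hv, rfl⟩; exact hv
    · exact fun h => ⟨_, h, rfl⟩
  -- The nodes whose bags meet the component. They are joined within `D`, because the component is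
  -- connected and adjacent vertices share a bag.
  let D : Set ι := {i | ∃ v : Fin n, Comp n (NatAdj G) X c v ∧ v ∈ bag i}
  have hbagD : ∀ v : Fin n, Comp n (NatAdj G) X c v → {i | v ∈ bag i} ⊆ D :=
    fun v hv i hi => ⟨v, hv, hi⟩
  have key : ∀ (i : ι) (v : Fin n), Comp n (NatAdj G) X c v → v ∈ bag i → ∀ u,
      Comp n (NatAdj G) X v u → ∀ (hu : u < n) l, (⟨u, hu⟩ : Fin n) ∈ bag l → JoinedIn T D i l := by
    rintro i v hcv hvi u ⟨hv, hvu⟩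
    induction hvu with
    | refl =>
      intro hu l hl
      exact (joinedIn_of_connected (h.connected v) hvi hl).mono (hbagD v hcv)
    | @tail x y hx hxy ih =>
      rintro hy l hl
      obtain ⟨⟨hx', hy', hadj⟩, hyX⟩ := hxy
      obtain ⟨m, hm1, hm2⟩ := h.edge _ _ hadj
      have hcy : Comp n (NatAdj G) X c y := hcv.trans ⟨hv, hx.tail ⟨⟨hx', hy', hadj⟩, hyX⟩⟩
      exact (ih hx' m hm1).trans
        ((joinedIn_of_connected (h.connected ⟨y, hy⟩) hm2 hl).mono (hbagD ⟨y, hy⟩ hcy))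
  have hD : ∀ i ∈ D, ∀ l ∈ D, JoinedIn T D i l := by
    rintro i ⟨v, hv, hvi⟩ l ⟨u, hu, hul⟩
    exact key i v hv hvi u ((hv.symm hlt (NatAdj.symm G)).trans hu) u.2 l hul
  obtain ⟨i₀, hi₀⟩ := h.cover ⟨c, hc⟩
  -- The gate of `D` towards `j` is the required bag: the nodes of an outside neighbour `y` contain
  -- `j`, and they meet `D` through an edge from `y` to the component, so they contain the gate.
  obtain ⟨i, ⟨v, hv, hvi⟩, hi⟩ := exists_gate h.isTree hD ⟨i₀, ⟨c, hc⟩, .refl hc hX, hi₀⟩ j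
  refine ⟨v, _, ⟨i, rfl⟩, hv, (hmem i v v.2).2 hvi, fun x y hx hxy => ?_⟩
  refine (hB x y hx hxy).imp_right fun hyj => ?_
  obtain ⟨hxn, hyn, hadj⟩ := hxy
  obtain ⟨m, hm1, hm2⟩ := h.edge _ _ hadj
  exact (hmem i y hyn).2 (hi _ (h.connected ⟨y, hyn⟩) ((hmem j y hyn).1 hyj)
    ⟨m, ⟨⟨x, hxn⟩, hx, hm1⟩, hm2⟩)

/-- A single bag will do. This makes the set of widths nonempty, so that `treewidth` is an attained
minimum and not the default infimum `0`. -/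
theorem hasTreeDecompositionOfWidth_card {n : ℕ} (G : SimpleGraph (Fin n)) :
    HasTreeDecompositionOfWidth G n := by
  refine ⟨1, ⊥, fun _ => Finset.univ, ⟨?_, fun v => ⟨0, by simp⟩, fun u v _ => ⟨0, by simp⟩, ?_⟩,
    fun i => by simp⟩
  · exact SimpleGraph.IsTree.of_subsingleton
  · intro u
    have : Nonempty {i : Fin 1 | u ∈ (Finset.univ : Finset (Fin n))} := ⟨⟨0, by simp⟩⟩
    exact ⟨SimpleGraph.Preconnected.of_subsingleton⟩

theorem exists_absorbing {n t : ℕ} {G : SimpleGraph (Fin n)} (h : treewidth G ≤ t) :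
    ∃ F : Set (Finset ℕ), Absorbing n (NatAdj G) F ∧ F.Nonempty ∧ ∀ B ∈ F, B.card ≤ t + 1 := by
  obtain ⟨m, T, bag, hT, hw⟩ : HasTreeDecompositionOfWidth G (treewidth G) :=
    Nat.sInf_mem (s := {w | HasTreeDecompositionOfWidth G w})
      ⟨n, hasTreeDecompositionOfWidth_card G⟩
  refine ⟨_, absorbing_bags hT, ?_, ?_⟩
  · have := hT.isTree.1.nonempty
    exact Set.range_nonempty _
  · rintro _ ⟨i, rfl⟩
    have := hw i
    rw [Finset.card_map]
    omega


/-! ## Connected Maximum Cut as a labelling problem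

The label of a vertex is a level and a parent. A level is positive if the vertex is in the solution
`S`; every vertex of `S` but the root `r` needs a parent of smaller level among its neighbours in
`S`, so that `S` is connected. -/

/-- The level in the literal `e`. -/
def level (b e : ℕ) : ℕ := e / b % b

/-- The reward for a vertex that satisfies its connectivity constraint. -/
def reward (n : ℕ) : ℕ := 2 ^ n * (n * n + 1)

open Classical in
/-- The weight of a pair of literals: the reward for satisfied constraints, `2 ^ n` for an edge of
the cut, and `2 ^ u` for a vertex `u` of the solution. -/
noncomputable def cmcWeight (n : ℕ) (A : ℕ → ℕ → Prop) (r e e' : ℕ) : ℕ :=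
  if e / (n + 2) ^ 2 = e' / (n + 2) ^ 2 then
    (if (e / (n + 2) ^ 2 = r ∧ 0 < level (n + 2) e) ∨ (¬ e / (n + 2) ^ 2 = r ∧ level (n + 2) e = 0)
      then reward n else 0) +
    if 0 < level (n + 2) e then 2 ^ (e / (n + 2) ^ 2) else 0
  else if A (e / (n + 2) ^ 2) (e' / (n + 2) ^ 2) then
    (if 0 < level (n + 2) e ∧ level (n + 2) e' = 0 then 2 ^ n else 0) +
    if (¬ e / (n + 2) ^ 2 = r ∧ e % (n + 2) = e' / (n + 2) ^ 2) ∧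
      0 < level (n + 2) e' ∧ level (n + 2) e' < level (n + 2) e then reward n else 0
  else 0

theorem cmcWeight_ne_zero {n : ℕ} {A : ℕ → ℕ → Prop} {r e e' : ℕ} (h : cmcWeight n A r e e' ≠ 0) :
    e / (n + 2) ^ 2 = e' / (n + 2) ^ 2 ∨ A (e / (n + 2) ^ 2) (e' / (n + 2) ^ 2) := by
  by_contra hn
  push Not at hn
  simp [cmcWeight, hn.1, hn.2] at h

/-! ### The three scales of the weight -/

section Value

variable {n : ℕ} (A : ℕ → ℕ → Prop) (r : ℕ) (f : ℕ → ℕ)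

/-- The constraint of `u` is satisfied. -/
def Satisfied (n : ℕ) (A : ℕ → ℕ → Prop) (r : ℕ) (f : ℕ → ℕ) (u : ℕ) : Prop :=
  (u = r ∧ 0 < level (n + 2) (f u)) ∨ (¬ u = r ∧ level (n + 2) (f u) = 0) ∨
    ∃ v < n, v ≠ u ∧ A u v ∧ ((¬ u = r ∧ f u % (n + 2) = v) ∧
      0 < level (n + 2) (f v) ∧ level (n + 2) (f v) < level (n + 2) (f u))

open Classical in
/-- The number of pairs of adjacent vertices from the solution to its complement. -/
noncomputable def cutCount (n : ℕ) (A : ℕ → ℕ → Prop) (p : ℕ → Prop) : ℕ :=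
  ∑ u ∈ Finset.range n, ∑ v ∈ Finset.range n, if A u v ∧ p u ∧ ¬ p v then 1 else 0

open Classical in
/-- The number with binary digits `p`. -/
noncomputable def bits (n : ℕ) (p : ℕ → Prop) : ℕ :=
  ∑ u ∈ Finset.range n, if p u then 2 ^ u else 0

-- No vertex earns two rewards: its label names only one parent, and the parent rule requires `u ≠
-- r` and a positive level of `u`, which excludes both rewards given on the diagonal.
open Classical in
theorem weight_cmcWeight (hA : ∀ u, ¬ A u u) (hf : ∀ u, f u / (n + 2) ^ 2 = u) :
    weight n (cmcWeight n A r) (· < n) f =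
      reward n * (∑ u ∈ Finset.range n, if Satisfied n A r f u then 1 else 0) +
        (2 ^ n * cutCount n A (fun u => 0 < level (n + 2) (f u)) +
          bits n (fun u => 0 < level (n + 2) (f u))) := by
  unfold weight cutCount bits
  rw [Finset.mul_sum, Finset.mul_sum, ← Finset.sum_add_distrib, ← Finset.sum_add_distrib]
  refine Finset.sum_congr rfl fun u hu => ?_
  rw [Finset.mem_range] at hu
  have e1 : ∀ v ∈ Finset.range n,
      (if u < n ∨ v < n then cmcWeight n A r (f u) (f v) else 0) =
      ((if u = v then ((if (u = r ∧ 0 < level (n + 2) (f u)) ∨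
          (¬ u = r ∧ level (n + 2) (f u) = 0) then reward n else 0) +
          if 0 < level (n + 2) (f u) then 2 ^ u else 0) else 0) +
      (if f u % (n + 2) = v then (if v ≠ u ∧ A u v ∧ (¬ u = r ∧
          0 < level (n + 2) (f v) ∧ level (n + 2) (f v) < level (n + 2) (f u)) then reward n
          else 0) else 0)) +
      2 ^ n * (if A u v ∧ 0 < level (n + 2) (f u) ∧ ¬ 0 < level (n + 2) (f v) then 1 else 0) := by
    intro v hv
    rw [if_pos (.inl hu), cmcWeight, hf, hf]
    by_cases huv : u = v
    · subst huv
      simp [hA]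
    · by_cases hadj : A u v
      · have huv' : v ≠ u := Ne.symm huv
        by_cases hp : f u % (n + 2) = v
        · simp [huv, huv', hadj, hp]
          ring
        · simp [huv, hadj, hp]
      · simp [huv, hadj]
  refine Eq.trans (Finset.sum_congr rfl fun v hv => Eq.trans (by congr!) (e1 v hv)) ?_
  rw [Finset.sum_add_distrib, Finset.sum_add_distrib, Finset.mul_sum]
  simp only [Finset.sum_ite_eq, Finset.mem_range, hu, if_true]
  have hsat : reward n * (if Satisfied n A r f u then 1 else 0) =
      (if (u = r ∧ 0 < level (n + 2) (f u)) ∨ (¬ u = r ∧ level (n + 2) (f u) = 0) then reward n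
        else 0) +
      if f u % (n + 2) < n then (if f u % (n + 2) ≠ u ∧ A u (f u % (n + 2)) ∧ (¬ u = r ∧
          0 < level (n + 2) (f (f u % (n + 2))) ∧
          level (n + 2) (f (f u % (n + 2))) < level (n + 2) (f u)) then reward n
          else 0) else 0 := by
    have hS : Satisfied n A r f u ↔ ((u = r ∧ 0 < level (n + 2) (f u)) ∨
        (¬ u = r ∧ level (n + 2) (f u) = 0)) ∨ (f u % (n + 2) < n ∧ (f u % (n + 2) ≠ u ∧
          A u (f u % (n + 2)) ∧ (¬ u = r ∧ 0 < level (n + 2) (f (f u % (n + 2))) ∧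
          level (n + 2) (f (f u % (n + 2))) < level (n + 2) (f u)))) := by
      constructor
      · rintro (h | h | ⟨v, h1, h2, h3, ⟨h4, rfl⟩, h5⟩)
        · exact .inl (.inl h)
        · exact .inl (.inr h)
        · exact .inr ⟨h1, h2, h3, h4, h5⟩
      · rintro ((h | h) | ⟨h1, h2, h3, h4, h5⟩)
        · exact .inl h
        · exact .inr (.inl h)
        · exact .inr (.inr ⟨_, h1, h2, h3, ⟨h4, rfl⟩, h5⟩)
    rw [← ite_and]
    by_cases h1 : (u = r ∧ 0 < level (n + 2) (f u)) ∨ (¬ u = r ∧ level (n + 2) (f u) = 0)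
    · rw [if_pos (hS.2 (.inl h1)), if_pos h1, if_neg]
      · ring
      · rintro ⟨-, -, -, h4, -, h5⟩
        rcases h1 with h1 | h1
        · exact h4 h1.1
        · omega
    · rw [if_neg h1]
      simp only [hS, h1, false_or]
      simp
  rw [hsat]
  ring_nf

theorem bits_lt (p : ℕ → Prop) : ∀ n, bits n p < 2 ^ n
  | 0 => by simp [bits]
  | n + 1 => by
    classical
    have := bits_lt p n
    unfold bits at this ⊢
    rw [Finset.sum_range_succ, pow_succ]
    split_ifs <;> omega

/-- The inequality says that binary digit `u` is one, and multiples of `2 ^ n` do not affect the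
digits below `n`. The induction moves the top digit of `bits` into `m`. -/
theorem le_bits_mod_iff (p : ℕ → Prop) (m : ℕ) : ∀ n, ∀ u < n,
    (2 ^ u ≤ (2 ^ n * m + bits n p) % 2 ^ (u + 1) ↔ p u)
  | 0, _, h => absurd h (Nat.not_lt_zero _)
  | n + 1, u, h => by
    classical
    rcases Nat.lt_succ_iff_lt_or_eq.1 h with hu | rfl
    · have := le_bits_mod_iff p (2 * m + if p n then 1 else 0) n u hu
      rw [← this]
      have e : 2 ^ (n + 1) * m + bits (n + 1) p =
          2 ^ n * (2 * m + if p n then 1 else 0) + bits n p := by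
        unfold bits
        rw [Finset.sum_range_succ, pow_succ]
        split_ifs <;> ring
      rw [e]
    · rw [Nat.mul_add_mod, Nat.mod_eq_of_lt (bits_lt p _)]
      have := bits_lt p u
      have e : bits (u + 1) p = bits u p + if p u then 2 ^ u else 0 := by
        unfold bits
        rw [Finset.sum_range_succ]
      rw [e]
      split_ifs with hp
      · simp [hp]
      · simpa [hp] using this

end Value

/-- Each cut edge has exactly one orientation that leaves the solution, so counting ordered pairs
repeats nothing. -/
theorem ncard_cut {n : ℕ} (G : SimpleGraph (Fin n)) (p : ℕ → Prop) :
    (cut G {v : Fin n | p v}).ncard = cutCount n (NatAdj G) p := by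
  classical
  have h1 : cutCount n (NatAdj G) p = ((Finset.univ : Finset (Fin n × Fin n)).filter
      fun x => G.Adj x.1 x.2 ∧ p x.1 ∧ ¬ p x.2).card := by
    unfold cutCount
    rw [Finset.card_filter, Fintype.sum_prod_type, Finset.sum_range]
    refine Finset.sum_congr rfl fun u _ => ?_
    rw [Finset.sum_range]
    refine Finset.sum_congr rfl fun v _ => ?_
    have : NatAdj G u v ↔ G.Adj u v := ⟨fun h => h.2.2, fun h => ⟨u.2, v.2, h⟩⟩
    simp only [this]
  rw [h1, ← Set.ncard_coe_finset,
    ← Set.InjOn.ncard_image (f := fun x : Fin n × Fin n => s(x.1, x.2))]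
  · congr 1
    ext e
    induction e with | _ a b
    simp only [cut, Set.mem_ofPred_eq, SimpleGraph.mem_edgeSet, Sym2.mem_iff, Set.mem_image,
      Finset.coe_filter, Finset.mem_univ, true_and, Prod.exists, Sym2.eq_iff]
    constructor
    · rintro ⟨hab, ⟨u, rfl | rfl, hu⟩, v, rfl | rfl, hv⟩
      · exact absurd hu hv
      · exact ⟨_, _, ⟨hab, hu, hv⟩, .inl ⟨rfl, rfl⟩⟩
      · exact ⟨_, _, ⟨hab.symm, hu, hv⟩, .inr ⟨rfl, rfl⟩⟩
      · exact absurd hu hv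
    · rintro ⟨u, v, ⟨h1, h2, h3⟩, ⟨rfl, rfl⟩ | ⟨rfl, rfl⟩⟩
      · exact ⟨h1, ⟨u, .inl rfl, h2⟩, v, .inr rfl, h3⟩
      · exact ⟨h1.symm, ⟨u, .inr rfl, h2⟩, v, .inl rfl, h3⟩
  · rintro ⟨a, b⟩ hab ⟨a', b'⟩ hab' h
    simp only [Finset.coe_filter, Finset.mem_univ, true_and, Set.mem_ofPred_eq] at hab hab'
    simp only [Sym2.eq_iff] at h
    rcases h with ⟨rfl, rfl⟩ | ⟨rfl, rfl⟩
    · rfl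
    · exact absurd hab.2.1 hab'.2.2

/-- If all constraints are satisfied, the solution is connected. -/
theorem connected_of_satisfied {n : ℕ} {G : SimpleGraph (Fin n)} {r : ℕ} (hr : r < n) {f : ℕ → ℕ}
    (h : ∀ u < n, Satisfied n (NatAdj G) r f u) :
    (G.induce {v : Fin n | 0 < level (n + 2) (f v)}).Connected := by
  have hr0 : 0 < level (n + 2) (f r) := by
    rcases h r hr with h | h | ⟨v, -, -, -, h, -⟩
    · exact h.2
    · exact absurd rfl h.1
    · exact absurd rfl h.1
  let S : Set (Fin n) := {v : Fin n | 0 < level (n + 2) (f v)}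
  let r' : S := ⟨⟨r, hr⟩, hr0⟩
  -- Levels drop strictly from a vertex to its parent, so following parents ends at the root.
  have key : ∀ m, ∀ u : S, level (n + 2) (f u.1) = m → (G.induce S).Reachable u r' := by
    intro m
    induction m using Nat.strong_induction_on with
    | _ m ih =>
      rintro ⟨⟨u, hu⟩, hu0⟩ hm
      change 0 < level (n + 2) (f u) at hu0
      rcases h u hu with h | h | ⟨v, hv, -, ⟨_, _, hadj⟩, -, h0, hlt⟩
      · have : (⟨⟨u, hu⟩, hu0⟩ : S) = r' := Subtype.ext (Fin.ext h.1)
        rw [this]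
      · omega
      · refine (SimpleGraph.Adj.reachable (v := (⟨⟨v, hv⟩, h0⟩ : S)) ?_).trans
          (ih _ (hm ▸ hlt) ⟨⟨v, hv⟩, h0⟩ rfl)
        exact hadj
  have : Nonempty S := ⟨r'⟩
  exact ⟨fun u v => (key _ u rfl).trans (key _ v rfl).symm⟩

/-- A connected set is the solution of a labelling that satisfies all constraints. -/
theorem exists_satisfied {n : ℕ} {G : SimpleGraph (Fin n)} {S : Set (Fin n)}
    (hS : (G.induce S).Connected) : ∃ r < n, ∃ f : ℕ → ℕ, (∀ u, f u / (n + 2) ^ 2 = u) ∧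
      (∀ u < n, Satisfied n (NatAdj G) r f u) ∧ {v : Fin n | 0 < level (n + 2) (f v)} = S := by
  classical
  obtain ⟨r⟩ := hS.nonempty
  -- In `S`, the level is one more than the distance to the root in `G[S]`, and the parent is the
  -- next vertex on a shortest path. Distances are below `n`, so level and parent fit into a label.
  have hex : ∀ u : ℕ, ∃ l ≤ n, ∃ p < n, ∀ hu : u < n, (0 < l ↔ (⟨u, hu⟩ : Fin n) ∈ S) ∧
      ∀ h : (⟨u, hu⟩ : Fin n) ∈ S, l = (G.induce S).dist ⟨_, h⟩ r + 1 ∧ (u ≠ r.1 →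
        ∃ (hp : p < n) (h' : (⟨p, hp⟩ : Fin n) ∈ S), G.Adj ⟨u, hu⟩ ⟨p, hp⟩ ∧
          (G.induce S).dist ⟨_, h'⟩ r < (G.induce S).dist ⟨_, h⟩ r) := by
    intro u
    by_cases h : ∃ hu : u < n, (⟨u, hu⟩ : Fin n) ∈ S
    · obtain ⟨hu, h⟩ := h
      obtain ⟨w, hw⟩ := (hS.preconnected ⟨_, h⟩ r).exists_walk_length_eq_dist
      have hd : (G.induce S).dist ⟨_, h⟩ r < n := by
        obtain ⟨w', hw', hw''⟩ := (hS.preconnected ⟨_, h⟩ r).exists_path_of_dist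
        rw [← hw'']
        refine hw'.length_lt.trans_le ?_
        simpa using Fintype.card_subtype_le (· ∈ S)
      by_cases hur : u = r.1
      · exact ⟨_, hd, r.1, r.1.2, fun _ => ⟨by simpa using h,
          fun _ => ⟨rfl, fun h' => absurd hur h'⟩⟩⟩
      · cases w with
        | nil => exact absurd rfl hur
        | @cons _ v _ hadj w =>
          refine ⟨_, hd, v.1, v.1.2, fun _ => ⟨by simpa using h, fun _ => ⟨rfl, fun _ =>
            ⟨v.1.2, v.2, hadj, ?_⟩⟩⟩⟩
          have := SimpleGraph.dist_le w
          rw [SimpleGraph.Walk.length_cons] at hw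
          change (G.induce S).dist v r < _
          omega
    · exact ⟨0, Nat.zero_le _, r.1, r.1.2, fun hu => ⟨by simpa using fun h' => h ⟨hu, h'⟩,
        fun h' => absurd ⟨hu, h'⟩ h⟩⟩
  choose l hln p hpn hlp using hex
  have hlab : ∀ u, l u * (n + 2) + p u < (n + 2) ^ 2 := by
    intro u
    have h1 := Nat.mul_le_mul_right (n + 2) (hln u)
    have h2 := hpn u
    have h3 : (n + 2) ^ 2 = n * (n + 2) + (n + 2) + (n + 2) := by ring
    omega
  let f : ℕ → ℕ := fun u => u * (n + 2) ^ 2 + (l u * (n + 2) + p u)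
  have hfv : ∀ u, f u / (n + 2) ^ 2 = u := by
    intro u
    simp only [f]
    rw [add_comm, Nat.add_mul_div_right _ _ (by positivity), Nat.div_eq_of_lt (hlab u), zero_add]
  have hfe : ∀ u, f u = p u + (n + 2) * (l u + (n + 2) * u) := by
    intro u; simp only [f]; ring
  have hfl : ∀ u, level (n + 2) (f u) = l u := by
    intro u
    have := hpn u
    have := hln u
    rw [level, hfe, Nat.add_mul_div_left _ _ (by omega), Nat.div_eq_of_lt (by omega), zero_add,
      Nat.add_mul_mod_self_left, Nat.mod_eq_of_lt (by omega)]
  have hfp : ∀ u, f u % (n + 2) = p u := by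
    intro u
    have := hpn u
    rw [hfe, Nat.add_mul_mod_self_left, Nat.mod_eq_of_lt (by omega)]
  refine ⟨r.1, r.1.2, f, hfv, fun u hu => ?_, ?_⟩
  · obtain ⟨h1, h2⟩ := hlp u hu
    unfold Satisfied
    simp only [hfl, hfp]
    by_cases hur : u = r.1
    · exact .inl ⟨hur, h1.2 (by simp [hur])⟩
    by_cases hl0 : l u = 0
    · exact .inr (.inl ⟨hur, hl0⟩)
    have huS := h1.1 (Nat.pos_of_ne_zero hl0)
    obtain ⟨h3, h4⟩ := h2 huS
    obtain ⟨hp, hpS, hadj, hd⟩ := h4 hur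
    have h5 := ((hlp (p u) hp).2 hpS).1
    refine .inr (.inr ⟨p u, hp, fun h => ?_, ⟨hu, hp, hadj⟩, ⟨hur, rfl⟩, ?_, ?_⟩)
    · exact hadj.ne (Fin.ext h.symm)
    · omega
    · omega
  · ext v
    simp only [Set.mem_ofPred_eq, hfl]
    exact (hlp v v.2).1

/-- The optimum over all roots. -/
noncomputable def optimum (n : ℕ) (C : ℕ → ℕ → ℕ → Prop) (T : ℕ → ℕ → ℕ → ℕ) : ℕ :=
  (Finset.range n).sup fun r => total n C (T r)

/-- The binary digits of the optimum of the dynamic program are an optimal solution, and the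
optimum is not too large. -/
theorem isOptimalCMC_bits {n t : ℕ} (hn : 0 < n) {G : SimpleGraph (Fin n)} (ht : treewidth G ≤ t)
    {x : ℕ} (hx : x = optimum n (component (t + 1) n (NatAdj G))
      fun r => value (n + 2) n (NatAdj G) (t + 1) (cmcWeight n (NatAdj G) r) n) :
    IsOptimalCMC G {v : Fin n | 2 ^ (v : ℕ) ≤ x % 2 ^ ((v : ℕ) + 1)} ∧
      x < 2 ^ n * ((n * n + 1) * (n + 1)) := by
  classical
  obtain ⟨F, hF, hFn, hFt⟩ := exists_absorbing ht
  have hlt := NatAdj.lt G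
  have hsymm := NatAdj.symm G
  have hirr : ∀ u, ¬ NatAdj G u u := fun u h => h.2.2.ne rfl
  have hcut : ∀ p, cutCount n (NatAdj G) p ≤ n * n := by
    intro p
    unfold cutCount
    refine (Finset.sum_le_card_nsmul _ _ n fun u _ => ?_).trans (by simp)
    refine (Finset.sum_le_card_nsmul _ _ 1 fun v _ => ?_).trans (by simp)
    split_ifs <;> simp
  have hupper : ∀ r < n, ∀ f : ℕ → ℕ, (∀ u, f u / (n + 2) ^ 2 = u) →
      weight n (cmcWeight n (NatAdj G) r) (· < n) f ≤ x := by
    intro r hr f hf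
    rw [hx]
    exact (weight_le_total hlt hsymm (fun _ _ => cmcWeight_ne_zero) (by omega) hF hFn hFt hf).trans
      (Finset.le_sup (f := fun r => total n (component (t + 1) n (NatAdj G))
        (value (n + 2) n (NatAdj G) (t + 1) (cmcWeight n (NatAdj G) r) n)) (Finset.mem_range.2 hr))
  obtain ⟨r, hr, f, hf, hxf⟩ : ∃ r < n, ∃ f : ℕ → ℕ, (∀ u, f u / (n + 2) ^ 2 = u) ∧
      x = weight n (cmcWeight n (NatAdj G) r) (· < n) f := by
    obtain ⟨r, hr, hxr⟩ := Finset.exists_mem_eq_sup (Finset.range n) ⟨0, Finset.mem_range.2 hn⟩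
      (fun r => total n (component (t + 1) n (NatAdj G))
        (value (n + 2) n (NatAdj G) (t + 1) (cmcWeight n (NatAdj G) r) n))
    rw [Finset.mem_range] at hr
    obtain ⟨f, hf, hle⟩ := exists_total_le_weight hlt hsymm (k := t + 1)
      (W := cmcWeight n (NatAdj G) r)
      (fun _ _ => cmcWeight_ne_zero) (by omega) n
    exact ⟨r, hr, f, hf, le_antisymm (by rw [hx, optimum, hxr]; exact hle) (hupper r hr f hf)⟩
  have hlow : ∀ S : Set (Fin n), (G.induce S).Connected →
      reward n * n + 2 ^ n * (cut G S).ncard ≤ x := by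
    intro S hS
    obtain ⟨r, hr, f, hf, hsat, rfl⟩ := exists_satisfied hS
    refine le_trans ?_ (hupper r hr f hf)
    rw [weight_cmcWeight _ _ _ hirr hf, ncard_cut G fun u => 0 < level (n + 2) (f u)]
    have : (∑ u ∈ Finset.range n, if Satisfied n (NatAdj G) r f u then 1 else 0) = n := by
      rw [Finset.sum_congr rfl fun u hu => if_pos (hsat u (Finset.mem_range.1 hu))]
      simp
    rw [this]
    omega
  set p : ℕ → Prop := fun u => 0 < level (n + 2) (f u) with hp
  replace hxf : x = reward n *
      (∑ u ∈ Finset.range n, if Satisfied n (NatAdj G) r f u then 1 else 0) +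
      (2 ^ n * cutCount n (NatAdj G) p + bits n p) := hxf.trans (weight_cmcWeight _ _ _ hirr hf)
  have hb := bits_lt p n
  have hc := Nat.mul_le_mul_left (2 ^ n) (hcut p)
  -- Cut and tie-breaker together are worth less than one reward.
  have hrest : 2 ^ n * cutCount n (NatAdj G) p + bits n p < reward n := by
    rw [reward, mul_add]
    omega
  have hsatle : (∑ u ∈ Finset.range n, if Satisfied n (NatAdj G) r f u then 1 else 0) ≤ n := by
    rw [← Finset.card_filter]
    exact (Finset.card_filter_le _ _).trans (Finset.card_range n).le
  have hsatn : (∑ u ∈ Finset.range n, if Satisfied n (NatAdj G) r f u then 1 else 0) = n := by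
    refine le_antisymm hsatle ?_
    -- A singleton is connected, so all `n` rewards can be had at once, and an optimal labelling
    -- forgoes none.
    have h1 : (G.induce {(⟨0, hn⟩ : Fin n)}).Connected := SimpleGraph.Connected.of_subsingleton
    have h2 := hlow _ h1
    by_contra hlt'
    have h3 := Nat.mul_le_mul_left (reward n) (Nat.succ_le_of_lt (not_le.1 hlt'))
    rw [Nat.succ_eq_add_one, mul_add] at h3
    omega
  have hsat : ∀ u < n, Satisfied n (NatAdj G) r f u := by
    rw [← Finset.card_filter] at hsatn
    intro u hu
    have := Finset.eq_of_subset_of_card_le (Finset.filter_subset _ _)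
      (hsatn.trans (Finset.card_range n).symm).ge
    have hmem := Finset.mem_range.2 hu
    rw [← this] at hmem
    exact (Finset.mem_filter.1 hmem).2
  rw [hsatn] at hxf
  have hS : {v : Fin n | 2 ^ (v : ℕ) ≤ x % 2 ^ ((v : ℕ) + 1)} = {v : Fin n | p v} := by
    ext v
    have e : x = 2 ^ n * ((n * n + 1) * n + cutCount n (NatAdj G) p) + bits n p := by
      rw [hxf, reward]; ring
    rw [Set.mem_ofPred_eq, e]
    exact le_bits_mod_iff p _ n v v.2
  refine ⟨?_, ?_⟩
  · rw [hS]
    refine ⟨connected_of_satisfied hr hsat, fun S' hS' => ?_⟩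
    have h1 := hlow S' hS'
    rw [ncard_cut]
    -- One more cut edge would gain `2 ^ n`, more than `bits` can make up for.
    by_contra h2
    have h3 := Nat.mul_le_mul_left (2 ^ n) (Nat.succ_le_of_lt (not_le.1 h2))
    rw [Nat.succ_eq_add_one, mul_add] at h3
    omega
  · have e : 2 ^ n * ((n * n + 1) * (n + 1)) = reward n * n + reward n := by rw [reward]; ring
    omega


/-! ## The tables of the dynamic program -/

section Tables

/-- The cell for `s < b`, `q < b ^ (3 * k)`, `x < b` and `y < b`. -/
def cell (b k s q x y : ℕ) : ℕ := b * (b * (b ^ (3 * k) * s + q) + x) + y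

open Classical in
/-- How to decide whether `u` can be reached from `c` in `s` steps that avoid the vertices of `q`,
given the answers for `s - 1` steps. -/
noncomputable def reachRule (n k : ℕ) (A : ℕ → ℕ → Prop) (R : ℕ → ℕ) (s q c u : ℕ) : ℕ :=
  if s = 0 then if u = c ∧ c < n ∧ ¬ Occurs (n + 2) k q c then 1 else 0
  else if R (cell (n + 2) k (s - 1) q c u) ≠ 0 ∨ (¬ Occurs (n + 2) k q u ∧
    ∃ w < n, R (cell (n + 2) k (s - 1) q c w) ≠ 0 ∧ A w u) then 1 else 0

/-- How to compute the value of the dynamic program after `s` steps for the root `r` from the values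
after `s - 1` steps. -/
noncomputable def valueRule (n k : ℕ) (A : ℕ → ℕ → Prop) (C : ℕ → ℕ → ℕ → Prop) (V : ℕ → ℕ)
    (s q r c : ℕ) : ℕ :=
  if s = 0 then 0 else step (n + 2) n A k C (cmcWeight n A r)
    (fun q' c' => V (cell (n + 2) k (s - 1) q' r c')) q c

/-- The table `R` obeys `rule`, whose last four arguments are decoded from the address. -/
def Obeys (b k : ℕ) (rule : (ℕ → ℕ) → ℕ → ℕ → ℕ → ℕ → ℕ) (R : ℕ → ℕ) (j : ℕ) : Prop :=
  R j = rule (fun i => if i < j then R i else 0) (j / b / b / b ^ (3 * k))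
    (j / b / b % b ^ (3 * k)) (j / b % b) (j % b)

/-- The step number is the most significant part of the address, so each layer lies entirely below
the next, as course-of-values recursion requires. -/
theorem cell_lt_cell {b k s s' q q' x x' y y' : ℕ} (hs : s < s') (hq : q < b ^ (3 * k))
    (hx : x < b) (hy : y < b) : cell b k s q x y < cell b k s' q' x' y' := by
  have h1 : b ^ (3 * k) * s + q + 1 ≤ b ^ (3 * k) * s' + q' := by
    have := Nat.mul_le_mul_left (b ^ (3 * k)) (Nat.succ_le_of_lt hs)
    rw [Nat.succ_eq_add_one, mul_add] at this
    omega
  have h2 : b * (b ^ (3 * k) * s + q) + x + 1 ≤ b * (b ^ (3 * k) * s' + q') + x' := by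
    have := Nat.mul_le_mul_left b h1
    rw [mul_add] at this
    omega
  have h3 := Nat.mul_le_mul_left b h2
  rw [mul_add] at h3
  unfold cell
  omega

theorem cell_lt {b k s q x y : ℕ} (hs : s < b) (hq : q < b ^ (3 * k))
    (hx : x < b) (hy : y < b) : cell b k s q x y < b ^ (3 * k + 3) := by
  have := cell_lt_cell (q' := 0) (x' := 0) (y' := 0) hs hq hx hy
  refine this.trans_eq ?_
  unfold cell
  ring

theorem Obeys.cell {b k s q x y : ℕ} {rule : (ℕ → ℕ) → ℕ → ℕ → ℕ → ℕ → ℕ} {R : ℕ → ℕ}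
    (h : ∀ j < b ^ (3 * k + 3), Obeys b k rule R j) (hs : s < b) (hq : q < b ^ (3 * k))
    (hx : x < b) (hy : y < b) :
    R (cell b k s q x y) =
      rule (fun i => if i < cell b k s q x y then R i else 0) s q x y := by
  have hb : 0 < b := by omega
  have h0 : 0 < b ^ (3 * k) := by positivity
  have e1 : ConnMaxCut.cell b k s q x y % b = y := by
    rw [ConnMaxCut.cell, Nat.mul_add_mod, Nat.mod_eq_of_lt hy]
  have e2 : ConnMaxCut.cell b k s q x y / b = b * (b ^ (3 * k) * s + q) + x := by
    rw [ConnMaxCut.cell, Nat.mul_add_div hb, Nat.div_eq_of_lt hy, add_zero]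
  have e3 : (b * (b ^ (3 * k) * s + q) + x) % b = x := by
    rw [Nat.mul_add_mod, Nat.mod_eq_of_lt hx]
  have e4 : (b * (b ^ (3 * k) * s + q) + x) / b = b ^ (3 * k) * s + q := by
    rw [Nat.mul_add_div hb, Nat.div_eq_of_lt hx, add_zero]
  have e5 : (b ^ (3 * k) * s + q) % b ^ (3 * k) = q := by
    rw [Nat.mul_add_mod, Nat.mod_eq_of_lt hq]
  have e6 : (b ^ (3 * k) * s + q) / b ^ (3 * k) = s := by
    rw [Nat.mul_add_div h0, Nat.div_eq_of_lt hq, add_zero]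
  have := h _ (cell_lt hs hq hx hy)
  rw [Obeys, e2, e1, e4, e3, e5, e6] at this
  exact this

variable {n k : ℕ} {A : ℕ → ℕ → Prop} (hlt : ∀ u v, A u v → u < n ∧ v < n)

/-- `u` can be reached from `c` in at most `s` steps avoiding `X`. -/
def ReachIn (n : ℕ) (A : ℕ → ℕ → Prop) (X : ℕ → Prop) : ℕ → ℕ → ℕ → Prop
  | 0, c, u => u = c ∧ c < n ∧ ¬ X c
  | s + 1, c, u => ReachIn n A X s c u ∨ (¬ X u ∧ ∃ w < n, ReachIn n A X s c w ∧ A w u)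

-- The set reached in `s` steps gains a vertex with every step until it is closed, and `n` vertices
-- leave no room for `n` gains after the first vertex.
include hlt in
theorem reachIn_iff {X : ℕ → Prop} {c u : ℕ} : ReachIn n A X n c u ↔ Comp n A X c u := by
  classical
  have h1 : ∀ s u, ReachIn n A X s c u → Comp n A X c u := by
    intro s
    induction s with
    | zero => rintro u ⟨rfl, h1, h2⟩; exact .refl h1 h2
    | succ s ih =>
      rintro u (h | ⟨h1, w, -, h2, h3⟩)
      · exact ih u h
      · exact (ih w h2).step h3 h1
  refine ⟨h1 n u, fun h => ?_⟩
  let S : ℕ → Finset ℕ := fun s => (Finset.range n).filter (ReachIn n A X s c)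
  have key : ∀ s, (∀ u, Comp n A X c u → ReachIn n A X s c u) ∨ s + 1 ≤ (S s).card := by
    intro s
    induction s with
    | zero =>
      right
      exact Finset.card_pos.2 ⟨c, Finset.mem_filter.2 ⟨Finset.mem_range.2 h.1.1, rfl, h.1⟩⟩
    | succ s ih =>
      rcases ih with ih | ih
      · exact .inl fun u hu => .inl (ih u hu)
      have hsub : S s ⊆ S (s + 1) := fun u hu =>
        Finset.mem_filter.2 ⟨(Finset.mem_filter.1 hu).1, .inl (Finset.mem_filter.1 hu).2⟩
      by_cases hss : S (s + 1) ⊆ S s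
      · left
        rintro u ⟨hc, hu⟩
        have : ReachIn n A X s c u := by
          induction hu with
          | refl =>
            have : ∀ s, ReachIn n A X s c c := by
              intro s
              induction s with
              | zero => exact ⟨rfl, hc⟩
              | succ s ih => exact .inl ih
            exact this s
          | @tail x y _ hxy ih =>
            have hx := hlt _ _ hxy.1
            exact (Finset.mem_filter.1 (hss (Finset.mem_filter.2 ⟨Finset.mem_range.2 hx.2,
              .inr ⟨hxy.2, x, hx.1, ih, hxy.1⟩⟩))).2
        exact .inl this
      · right
        have := Finset.card_lt_card (Finset.ssubset_iff_subset_ne.2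
          ⟨hsub, fun h => hss h.symm.subset⟩)
        omega
  rcases key n with h' | h'
  · exact h' u h
  · have := (Finset.card_filter_le (Finset.range n) (ReachIn n A X n c)).trans
      (Finset.card_range n).le
    simp only [S] at h'
    omega

include hlt in
theorem reach_table {R : ℕ → ℕ}
    (h : ∀ j < (n + 2) ^ (3 * k + 3), Obeys (n + 2) k (reachRule n k A) R j)
    {q c u : ℕ} (hq : q < (n + 2) ^ (3 * k)) (hc : c < n + 2) (hu : u < n + 2) :
    R (cell (n + 2) k n q c u) ≠ 0 ↔ component k n A q c u := by
  classical
  have hne : ∀ (p : Prop) [Decidable p], (if p then 1 else 0 : ℕ) ≠ 0 ↔ p := by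
    intro p _
    by_cases hp : p <;> simp [hp]
  have key : ∀ s < n + 2, ∀ u < n + 2, R (cell (n + 2) k s q c u) ≠ 0 ↔
      ReachIn n A (Occurs (n + 2) k q) s c u := by
    intro s
    induction s with
    | zero =>
      intro _ u hu
      rw [Obeys.cell h (by omega) hq hc hu, reachRule, if_pos rfl, hne, ReachIn]
    | succ s ih =>
      intro hs u hu
      have e : ∀ w < n + 2, (if cell (n + 2) k s q c w < cell (n + 2) k (s + 1) q c u then
          R (cell (n + 2) k s q c w) else 0) = R (cell (n + 2) k s q c w) :=
        fun w hw => if_pos (cell_lt_cell (by omega) hq hc hw)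
      rw [Obeys.cell h hs hq hc hu, reachRule, if_neg (by omega), hne, ReachIn,
        Nat.add_sub_cancel, e u hu, ih (by omega) u hu]
      have : (∃ w < n, (if cell (n + 2) k s q c w < cell (n + 2) k (s + 1) q c u then
          R (cell (n + 2) k s q c w) else 0) ≠ 0 ∧ A w u) ↔
          ∃ w < n, ReachIn n A (Occurs (n + 2) k q) s c w ∧ A w u := by
        refine exists_congr fun w => and_congr_right fun hw => ?_
        rw [e w (by omega), ih (by omega) w (by omega)]
      rw [this]
  rw [key n (by omega) u hu, reachIn_iff hlt]

/-- The first literal of an arbitrary code may name `n` or `n + 1`, which are not vertices. The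
tables have entries for these two numbers as well. -/
theorem headLit_div_lt (n q : ℕ) : headLit (n + 2) q / (n + 2) ^ 2 < n + 2 := by
  rw [Nat.div_lt_iff_lt_mul (by positivity)]
  have h1 := Nat.mod_lt q (show 0 < (n + 2) ^ 3 by positivity)
  have h2 : (n + 2) ^ 3 = (n + 2) * (n + 2) ^ 2 := by ring
  rw [headLit, ← h2]
  exact (Nat.sub_le _ _).trans_lt h1

/-- A step consults components and earlier values only at arguments within the range of the tables,
so agreement there suffices. -/
theorem step_congr {C C' : ℕ → ℕ → ℕ → Prop} {W : ℕ → ℕ → ℕ} {T T' : ℕ → ℕ → ℕ}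
    (hC : ∀ q < (n + 2) ^ (3 * k), ∀ c < n + 2, ∀ u < n + 2, C q c u ↔ C' q c u)
    (hT : ∀ q < (n + 2) ^ (3 * k), ∀ c < n, T q c = T' q c) {q c : ℕ}
    (hq : q < (n + 2) ^ (3 * k)) (hc : c < n + 2) :
    step (n + 2) n A k C W T q c = step (n + 2) n A k C' W T' q c := by
  classical
  refine Finset.sup_congr rfl fun q' hq' => ?_
  rw [Finset.mem_range] at hq'
  have hF : Follows (n + 2) n A k C q c q' ↔ Follows (n + 2) n A k C' q c q' := by
    unfold Follows
    refine and_congr_right fun _ => and_congr (hC q hq c hc _ (headLit_div_lt _ _))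
      (and_congr_right fun _ => forall_congr' fun x => forall_congr' fun hx => ?_)
    rw [hC q hq c hc x (by omega)]
    refine imp_congr_right fun _ => forall_congr' fun y => forall_congr' fun hy => ?_
    rw [hC q hq c hc y (by omega)]
  rw [if_congr hF rfl rfl]
  refine if_congr Iff.rfl (congrArg _ (Finset.sum_congr rfl fun c' hc' => ?_)) rfl
  rw [Finset.mem_range] at hc'
  have : ((C q c c' ∧ c' ≠ headLit (n + 2) q' / (n + 2) ^ 2) ∧ ∀ u < c', ¬ C q' c' u) ↔
      ((C' q c c' ∧ c' ≠ headLit (n + 2) q' / (n + 2) ^ 2) ∧ ∀ u < c', ¬ C' q' c' u) := by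
    rw [hC q hq c hc c' (by omega)]
    refine and_congr_right fun _ => forall_congr' fun u => forall_congr' fun hu => ?_
    rw [hC q' hq' c' (by omega) u (by omega)]
  rw [if_congr this (hT q' hq' c' hc') rfl]

theorem value_table {C : ℕ → ℕ → ℕ → Prop} {V : ℕ → ℕ}
    (hC : ∀ q < (n + 2) ^ (3 * k), ∀ c < n + 2, ∀ u < n + 2, C q c u ↔ component k n A q c u)
    (h : ∀ j < (n + 2) ^ (3 * k + 3), Obeys (n + 2) k (valueRule n k A C) V j) {r : ℕ}
    (hr : r < n + 2) : ∀ s < n + 2, ∀ q < (n + 2) ^ (3 * k), ∀ c < n + 2,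
    V (cell (n + 2) k s q r c) = value (n + 2) n A k (cmcWeight n A r) s q c
  | 0, hs, q, hq, c, hc => by
    rw [Obeys.cell h hs hq hr hc, valueRule, if_pos rfl, value]
  | s + 1, hs, q, hq, c, hc => by
    rw [Obeys.cell h hs hq hr hc, valueRule, if_neg (by omega), value]
    refine step_congr hC (fun q' hq' c' hc' => ?_) hq hc
    rw [Nat.add_sub_cancel, if_pos (cell_lt_cell (by omega) hq' hr (by omega)),
      value_table hC h hr s (by omega) q' hq' c' (by omega)]

theorem optimum_congr {C C' : ℕ → ℕ → ℕ → Prop} {T T' : ℕ → ℕ → ℕ → ℕ}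
    (hC : ∀ c < n, ∀ u < n, C 0 c u ↔ C' 0 c u) (hT : ∀ r < n, ∀ c < n, T r 0 c = T' r 0 c) :
    optimum n C T = optimum n C' T' := by
  classical
  refine Finset.sup_congr rfl fun r hr => Finset.sum_congr rfl fun c hc => ?_
  rw [Finset.mem_range] at hr hc
  have : (∀ u < c, ¬ C 0 c u) ↔ ∀ u < c, ¬ C' 0 c u :=
    forall_congr' fun u => forall_congr' fun hu => not_congr (hC c hc u (by omega))
  rw [if_congr this (hT r hr c hc) rfl]

/-- Removing the powers `2 ^ (L - 1)`, `2 ^ (L - 2)`, … in turn where possible. -/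
theorem rec_eq_mod {x L : ℕ} (hx : x < 2 ^ L) : ∀ i ≤ L,
    (Nat.rec x (fun i y => y - if 2 ^ (L - 1 - i) ≤ y then 2 ^ (L - 1 - i) else 0) i : ℕ) =
      x % 2 ^ (L - i)
  | 0, _ => (Nat.mod_eq_of_lt hx).symm
  | i + 1, hi => by
    have ih := rec_eq_mod hx i (by omega)
    simp only [ih]
    have e1 : L - i = (L - 1 - i) + 1 := by omega
    have e2 : L - (i + 1) = L - 1 - i := by omega
    -- The power is subtracted exactly if the top bit of the current remainder is one.
    rw [e1, e2, Nat.mod_pow_succ]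
    have h1 := Nat.mod_lt x (show 0 < 2 ^ (L - 1 - i) by positivity)
    rcases Nat.mod_two_eq_zero_or_one (x / 2 ^ (L - 1 - i)) with h | h
    · rw [h, mul_zero, add_zero, if_neg (by omega), Nat.sub_zero]
    · rw [h, mul_one, if_pos (by omega), Nat.add_sub_cancel]

end Tables

namespace RAM

/-! ## The program -/

/-- The bound for all loops: the number of cells of a table. -/
def loopBound (k n : ℕ) : ℕ := (n + 2) ^ (3 * k + 3)

/-- The adjacency relation stored in array `0`. -/
def storedAdj (σ : State) (u v : ℕ) : Prop :=
  (u < σ.reg 0 ∧ v < σ.reg 0) ∧ σ.arr 0 (u * σ.reg 0 + v) ≠ 0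

/-- The components stored in array `2`. -/
def storedComp (k : ℕ) (σ : State) (q c u : ℕ) : Prop :=
  σ.arr 2 (cell (σ.reg 0 + 2) k (σ.reg 0) q c u) ≠ 0

section Evaluable

variable {k r : ℕ}

theorem evaluable_base (hr : 2 ≤ r) : Evaluable (loopBound k) r (fun σ => σ.reg 0 + 2) :=
  .add (.reg hr (by omega)) (.lit hr 2)

theorem bounded_pow {m : ℕ} (hm : m ≤ 3 * k + 3) :
    Bounded (loopBound k) (fun σ => (σ.reg 0 + 2) ^ m) := fun σ hσ => by
  rw [hσ]
  exact Nat.pow_le_pow_right (by omega) hm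

theorem bounded_base : Bounded (loopBound k) (fun σ => σ.reg 0 + 2) := by
  simpa using bounded_pow (k := k) (m := 1) (by omega)

theorem bounded_size : Bounded (loopBound k) (fun σ => σ.reg 0) :=
  bounded_base.mono fun σ => by omega

theorem evaluable_pow (hr : 2 ≤ r) (m : ℕ) :
    Evaluable (loopBound k) r (fun σ => (σ.reg 0 + 2) ^ m) :=
  (evaluable_base hr).pow bounded_base m

theorem evaluable_size (hr : 2 ≤ r) : Evaluable (loopBound k) r (fun σ => σ.reg 0) :=
  .reg hr (by omega)

theorem testable_storedAdj {u v : State → ℕ} (hu : Evaluable (loopBound k) r u)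
    (hub : Bounded (loopBound k) u) (hv : Evaluable (loopBound k) r v) :
    Testable (loopBound k) r (fun σ => storedAdj σ (u σ) (v σ)) := by
  have hn := evaluable_size (k := k) hu.two_le
  exact ((Testable.lt hu hn).and (.lt hv hn)).and
    (Testable.not (.eq (.arr 0 ((hu.mul hub hn).add hv)) (.lit hu.two_le 0)))

theorem evaluable_cell {s q x y : State → ℕ} (hs : Evaluable (loopBound k) r s)
    (hq : Evaluable (loopBound k) r q) (hx : Evaluable (loopBound k) r x)
    (hy : Evaluable (loopBound k) r y) :
    Evaluable (loopBound k) r (fun σ => cell (σ.reg 0 + 2) k (s σ) (q σ) (x σ) (y σ)) := by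
  have hb := evaluable_base (k := k) hs.two_le
  exact .add (.mul hb bounded_base (.add (.mul hb bounded_base
    (.add (.mul (evaluable_pow hs.two_le _) (bounded_pow (by omega)) hs) hq)) hx)) hy

theorem testable_storedComp {q c u : State → ℕ} (hq : Evaluable (loopBound k) r q)
    (hc : Evaluable (loopBound k) r c) (hu : Evaluable (loopBound k) r u) :
    Testable (loopBound k) r (fun σ => storedComp k σ (q σ) (c σ) (u σ)) :=
  Testable.not (.eq (.arr 2 (evaluable_cell (evaluable_size hq.two_le) hq hc hu))
    (.lit hq.two_le 0))

theorem testable_hasLit : ∀ (m : ℕ) {q e : State → ℕ}, Evaluable (loopBound k) r q →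
    Bounded (loopBound k) q → Evaluable (loopBound k) r e →
    Testable (loopBound k) r (fun σ => HasLit (σ.reg 0 + 2) m (q σ) (e σ))
  | 0, q, e, hq, hqb, he => (Evaluable.lit hq.two_le 0).testable fun σ => by simp [HasLit]
  | m + 1, q, e, hq, hqb, he =>
    .or (.eq (hq.mod hqb (evaluable_pow hq.two_le 3)) (he.add (.lit hq.two_le 1)))
      (testable_hasLit m (hq.div hqb (evaluable_pow hq.two_le 3))
        (hqb.mono fun σ => Nat.div_le_self _ _) he)

theorem testable_occurs {q u : State → ℕ} (hq : Evaluable (loopBound k) r q)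
    (hqb : Bounded (loopBound k) q) (hu : Evaluable (loopBound k) r u) :
    Testable (loopBound k) r (fun σ => Occurs (σ.reg 0 + 2) k (q σ) (u σ)) :=
  .exists_lt (evaluable_pow hq.two_le 3) (bounded_pow (by omega)) fun s hs e he heb =>
    .and (testable_hasLit k (hq.mono hs) hqb he)
      (.eq (he.div heb (evaluable_pow he.two_le 2)) (hu.mono hs))

theorem evaluable_headLit {q : State → ℕ} (hq : Evaluable (loopBound k) r q)
    (hqb : Bounded (loopBound k) q) :
    Evaluable (loopBound k) r (fun σ => headLit (σ.reg 0 + 2) (q σ)) :=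
  .sub (hq.mod hqb (evaluable_pow hq.two_le 3)) (.lit hq.two_le 1)

theorem bounded_headLit {q : State → ℕ} (hqb : Bounded (loopBound k) q) :
    Bounded (loopBound k) (fun σ => headLit (σ.reg 0 + 2) (q σ)) :=
  hqb.mono fun _ => (Nat.sub_le _ _).trans (Nat.mod_le _ _)

theorem testable_follows {q c q' : State → ℕ} (hq : Evaluable (loopBound k) r q)
    (hqb : Bounded (loopBound k) q) (hc : Evaluable (loopBound k) r c)
    (hq' : Evaluable (loopBound k) r q') (hqb' : Bounded (loopBound k) q') :
    Testable (loopBound k) r (fun σ => Follows (σ.reg 0 + 2) (σ.reg 0) (storedAdj σ) k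
      (storedComp k σ) (q σ) (c σ) (q' σ)) := by
  have h2 := hq.two_le
  refine .and (.not (.eq (hq'.mod hqb' (evaluable_pow h2 3)) (.lit h2 0)))
    (.and (testable_storedComp hq hc ((evaluable_headLit hq' hqb').div (bounded_headLit hqb')
      (evaluable_pow h2 2))) (.and (.forall_lt (evaluable_pow h2 3) (bounded_pow (by omega))
      fun s hs e he heb => ?_) (.forall_lt (evaluable_size h2) bounded_size
      fun s hs x hx hxb => ?_)))
  · exact .imp (testable_hasLit k (hq'.mono hs) hqb' he)
      (.or (.eq he (evaluable_headLit (hq'.mono hs) hqb')) (testable_hasLit k (hq.mono hs) hqb he))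
  · refine .imp (testable_storedComp (hq.mono hs) (hc.mono hs) hx) (.forall_lt
      (evaluable_size hx.two_le) bounded_size fun s' hs' y hy hyb => ?_)
    exact .imp (testable_storedAdj (hx.mono hs') hxb hy)
      (.or (testable_storedComp (hq.mono (hs.trans hs')) (hc.mono (hs.trans hs')) hy)
        (testable_occurs (hq'.mono (hs.trans hs')) hqb' hy))

theorem evaluable_level {e : State → ℕ} (he : Evaluable (loopBound k) r e)
    (heb : Bounded (loopBound k) e) :
    Evaluable (loopBound k) r (fun σ => level (σ.reg 0 + 2) (e σ)) :=
  .mod (he.div heb (evaluable_base he.two_le)) (heb.mono fun _ => Nat.div_le_self _ _)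
    (evaluable_base he.two_le)

theorem evaluable_reward (hr : 2 ≤ r) :
    Evaluable (loopBound k) r (fun σ => reward (σ.reg 0)) := by
  have hn := evaluable_size (k := k) hr
  -- The polynomial factor comes first since it counts the additions; `2 ^ n` is too large for that.
  have := (((hn.mul bounded_size hn).add (.lit hr 1)).mul (fun σ hσ => ?_)
    (hn.two_pow bounded_size))
  · simpa only [reward, mul_comm (2 ^ _)] using this
  · refine le_trans ?_ (bounded_pow (k := k) (m := 2) (by omega) σ hσ)
    beta_reduce
    nlinarith

theorem evaluable_cmcWeight {v e e' : State → ℕ} (hv : Evaluable (loopBound k) r v)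
    (he : Evaluable (loopBound k) r e) (heb : Bounded (loopBound k) e)
    (he' : Evaluable (loopBound k) r e') (heb' : Bounded (loopBound k) e') :
    Evaluable (loopBound k) r
      (fun σ => cmcWeight (σ.reg 0) (storedAdj σ) (v σ) (e σ) (e' σ)) := by
  have h2 := he.two_le
  have hu := he.div heb (evaluable_pow h2 2)
  have hub : Bounded (loopBound k) (fun σ => e σ / (σ.reg 0 + 2) ^ 2) :=
    heb.mono fun σ => Nat.div_le_self _ _
  have hu' := he'.div heb' (evaluable_pow h2 2)
  have hl := evaluable_level he heb
  have hl' := evaluable_level he' heb'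
  have h0 : Evaluable (loopBound k) r (fun _ => 0) := .lit h2 0
  have hrew := evaluable_reward (k := k) h2
  unfold cmcWeight
  refine .ite (.eq hu hu') (.add (.ite (.or (.and (.eq hu hv) (.lt h0 hl))
    (.and (.not (.eq hu hv)) (.eq hl h0))) hrew h0) (.ite (.lt h0 hl) (hu.two_pow hub) h0))
    (.ite (testable_storedAdj hu hub hu') (.add (.ite (.and (.lt h0 hl) (.eq hl' h0))
      ((evaluable_size h2).two_pow bounded_size) h0) (.ite (.and (.and (.not (.eq hu hv))
      (.eq (he.mod heb (evaluable_base h2)) hu')) (.and (.lt h0 hl') (.lt hl' hl))) hrew h0)) h0)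

end Evaluable

end RAM

/-! ### Evaluating the rules of the tables -/

namespace RAM

section Evaluable

variable {k r : ℕ}

theorem evaluable_headWeight {v q : State → ℕ} (hv : Evaluable (loopBound k) r v)
    (hq : Evaluable (loopBound k) r q) (hqb : Bounded (loopBound k) q) :
    Evaluable (loopBound k) r (fun σ => headWeight (σ.reg 0 + 2) k
      (cmcWeight (σ.reg 0) (storedAdj σ) (v σ)) (q σ)) := by
  unfold headWeight
  refine .sum (evaluable_pow hq.two_le 3) (bounded_pow (by omega)) fun s hs e he heb => ?_
  have h2 := he.two_le
  have hq' := hq.mono hs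
  have hv' := hv.mono hs
  have hh := evaluable_headLit hq' hqb
  have hhb := bounded_headLit hqb
  exact .ite (testable_hasLit k hq' hqb he)
    (.ite (.eq (he.div heb (evaluable_pow h2 2)) (hh.div hhb (evaluable_pow h2 2)))
      (evaluable_cmcWeight hv' hh hhb hh hhb)
      (.add (evaluable_cmcWeight hv' hh hhb he heb) (evaluable_cmcWeight hv' he heb hh hhb)))
    (.lit h2 0)

theorem evaluable_step {T : State → ℕ → ℕ → ℕ} {v q c : State → ℕ}
    (hT : ∀ s, r ≤ s → ∀ q' c', Evaluable (loopBound k) s q' → Evaluable (loopBound k) s c' →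
      Evaluable (loopBound k) s (fun σ => T σ (q' σ) (c' σ)))
    (hv : Evaluable (loopBound k) r v) (hq : Evaluable (loopBound k) r q)
    (hqb : Bounded (loopBound k) q) (hc : Evaluable (loopBound k) r c) :
    Evaluable (loopBound k) r (fun σ => step (σ.reg 0 + 2) (σ.reg 0) (storedAdj σ) k
      (storedComp k σ) (cmcWeight (σ.reg 0) (storedAdj σ) (v σ)) (T σ) (q σ) (c σ)) := by
  unfold step
  refine .sup (evaluable_pow hq.two_le _) (bounded_pow (by omega)) fun s hs q' hq' hqb' => ?_
  have h2 := hq'.two_le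
  refine .ite (testable_follows (hq.mono hs) hqb (hc.mono hs) hq' hqb')
    (.add (evaluable_headWeight (hv.mono hs) hq' hqb')
      (.sum (evaluable_size h2) bounded_size fun s' hs' c' hc' hcb' => ?_)) (.lit h2 0)
  have h3 := hc'.two_le
  refine .ite (.and (.and (testable_storedComp (hq.mono (hs.trans hs')) (hc.mono (hs.trans hs'))
    hc') (.not (.eq hc' (.div (evaluable_headLit (hq'.mono hs') hqb') (bounded_headLit hqb')
      (evaluable_pow h3 2))))) (.forall_lt hc' hcb' fun s'' hs'' u hu _ => ?_))
    (hT s' (hs.trans hs') _ _ (hq'.mono hs') hc') (.lit h3 0)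
  exact .not (testable_storedComp (hq'.mono (hs'.trans hs'')) (hc'.mono hs'') hu)

theorem evaluable_optimum {T : State → ℕ → ℕ → ℕ → ℕ}
    (hT : ∀ s, r ≤ s → ∀ v q c, Evaluable (loopBound k) s v → Evaluable (loopBound k) s q →
      Evaluable (loopBound k) s c → Evaluable (loopBound k) s (fun σ => T σ (v σ) (q σ) (c σ)))
    (hr : 2 ≤ r) :
    Evaluable (loopBound k) r (fun σ => optimum (σ.reg 0) (storedComp k σ) (T σ)) := by
  unfold optimum total
  refine .sup (evaluable_size hr) bounded_size fun s hs v hv _ =>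
    .sum (evaluable_size hv.two_le) bounded_size fun s' hs' c hc hcb => ?_
  have h2 := hc.two_le
  refine .ite (.forall_lt hc hcb fun s'' hs'' u hu _ => ?_)
    (hT s' (hs.trans hs') _ _ _ (hv.mono hs') (.lit h2 0) hc) (.lit h2 0)
  exact .not (testable_storedComp (.lit hu.two_le 0) (hc.mono hs'') hu)

/-- The part of array `a` below `j`. -/
def below (a : ℕ) (σ : State) (j i : ℕ) : ℕ := if i < j then σ.arr a i else 0

theorem evaluable_below (a : ℕ) {j i : State → ℕ} (hj : Evaluable (loopBound k) r j)
    (hi : Evaluable (loopBound k) r i) :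
    Evaluable (loopBound k) r (fun σ => below a σ (j σ) (i σ)) :=
  .ite (.lt hi hj) (.arr a hi) (.lit hi.two_le 0)

theorem evaluable_reachRule {s q c u j : State → ℕ} (hj : Evaluable (loopBound k) r j)
    (hs : Evaluable (loopBound k) r s) (hq : Evaluable (loopBound k) r q)
    (hqb : Bounded (loopBound k) q) (hc : Evaluable (loopBound k) r c)
    (hu : Evaluable (loopBound k) r u) :
    Evaluable (loopBound k) r (fun σ => reachRule (σ.reg 0) k (storedAdj σ) (below 2 σ (j σ))
      (s σ) (q σ) (c σ) (u σ)) := by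
  have h2 := hs.two_le
  have h0 : Evaluable (loopBound k) r (fun _ => 0) := .lit h2 0
  have h1 : Evaluable (loopBound k) r (fun _ => 1) := .lit h2 1
  have hn := evaluable_size (k := k) h2
  unfold reachRule
  refine .ite (.eq hs h0) (.ite (.and (.eq hu hc) (.and (.lt hc hn)
    (.not (testable_occurs hq hqb hc)))) h1 h0) (.ite (.or (.not (.eq
    (evaluable_below 2 hj (evaluable_cell (.sub hs h1) hq hc hu)) h0))
    (.and (.not (testable_occurs hq hqb hu)) (.exists_lt hn bounded_size
    fun s' hs' w hw hwb => ?_))) h1 h0)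
  exact .and (.not (.eq (evaluable_below 2 (hj.mono hs') (evaluable_cell (.sub (hs.mono hs')
    (h1.mono hs')) (hq.mono hs') (hc.mono hs') hw)) (h0.mono hs')))
    (testable_storedAdj hw hwb (hu.mono hs'))

theorem evaluable_valueRule {s q v c j : State → ℕ} (hj : Evaluable (loopBound k) r j)
    (hs : Evaluable (loopBound k) r s) (hq : Evaluable (loopBound k) r q)
    (hqb : Bounded (loopBound k) q) (hv : Evaluable (loopBound k) r v)
    (hc : Evaluable (loopBound k) r c) :
    Evaluable (loopBound k) r (fun σ => valueRule (σ.reg 0) k (storedAdj σ) (storedComp k σ)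
      (below 3 σ (j σ)) (s σ) (q σ) (v σ) (c σ)) := by
  have h2 := hs.two_le
  have h0 : Evaluable (loopBound k) r (fun _ => 0) := .lit h2 0
  unfold valueRule
  refine .ite (.eq hs h0) h0 (evaluable_step (T := fun σ q' c' => below 3 σ (j σ)
    (cell (σ.reg 0 + 2) k (s σ - 1) q' (v σ) c')) (fun s' hs' q' c' hq' hc' => ?_) hv hq hqb hc)
  exact evaluable_below 3 (hj.mono hs') (evaluable_cell (.sub (hs.mono hs') (.lit hq'.two_le 1)) hq'
    (hv.mono hs') hc')

/-- Evaluating a rule at the arguments decoded from an address. -/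
theorem evaluable_decode {rule : State → ℕ → ℕ → ℕ → ℕ → ℕ → ℕ} {j : State → ℕ}
    (hrule : ∀ s q x y : State → ℕ, Evaluable (loopBound k) r s → Evaluable (loopBound k) r q →
      Bounded (loopBound k) q → Evaluable (loopBound k) r x → Evaluable (loopBound k) r y →
      Evaluable (loopBound k) r (fun σ => rule σ (j σ) (s σ) (q σ) (x σ) (y σ)))
    (hj : Evaluable (loopBound k) r j) (hjb : Bounded (loopBound k) j) :
    Evaluable (loopBound k) r (fun σ => rule σ (j σ)
      (j σ / (σ.reg 0 + 2) / (σ.reg 0 + 2) / (σ.reg 0 + 2) ^ (3 * k))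
      (j σ / (σ.reg 0 + 2) / (σ.reg 0 + 2) % (σ.reg 0 + 2) ^ (3 * k))
      (j σ / (σ.reg 0 + 2) % (σ.reg 0 + 2)) (j σ % (σ.reg 0 + 2))) := by
  have hb := evaluable_base (k := k) hj.two_le
  have hp := evaluable_pow (k := k) hj.two_le (3 * k)
  have h1 := hj.div hjb hb
  have hb1 : Bounded (loopBound k) (fun σ => j σ / (σ.reg 0 + 2)) :=
    hjb.mono fun σ => Nat.div_le_self _ _
  have h2 := h1.div hb1 hb
  have hb2 : Bounded (loopBound k) (fun σ => j σ / (σ.reg 0 + 2) / (σ.reg 0 + 2)) :=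
    hb1.mono fun σ => Nat.div_le_self _ _
  exact hrule _ _ _ _ (h2.div hb2 hp) (h2.mod hb2 hp) (hb2.mono fun σ => Nat.mod_le _ _)
    (h1.mod hb1 hb) (hj.mod hjb hb)

open Classical in
/-- The binary digit `u` of `x`, if `x < 2 ^ L`. -/
noncomputable def digit (L x u : ℕ) : ℕ :=
  if 2 ^ u ≤ (Nat.rec x (fun i y => y - if 2 ^ (L - 1 - i) ≤ y then 2 ^ (L - 1 - i) else 0)
    (L - 1 - u) : ℕ) then 1 else 0

theorem digit_ne_zero {L x u : ℕ} (hx : x < 2 ^ L) (hu : u < L) :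
    digit L x u ≠ 0 ↔ 2 ^ u ≤ x % 2 ^ (u + 1) := by
  classical
  have h := rec_eq_mod hx (L - 1 - u) (by omega)
  rw [show L - (L - 1 - u) = u + 1 by omega] at h
  rw [← h, digit]
  split_ifs with h'
  · simpa using h'
  · simpa using h'

/-- The optimum is exponentially large, so `div` and `mod` do not apply to it. Powers of two are
subtracted from the top instead, with register `1` as the number of binary positions. -/
theorem evaluable_digit {x u : State → ℕ} (hx : Evaluable (loopBound k) r x)
    (hu : Evaluable (loopBound k) r u) (hub : Bounded (loopBound k) u) :
    Evaluable (loopBound k) r (fun σ => digit (σ.reg 1) (x σ) (u σ)) := by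
  have h2 := hx.two_le
  have hL : ∀ s, 2 ≤ s → Evaluable (loopBound k) s (fun σ => σ.reg 1 - 1) :=
    fun s hs => .sub (.reg hs (by omega)) (.lit hs 1)
  have hLb : Bounded (loopBound k) (fun σ => σ.reg 1 - 1) := fun σ _ => Nat.sub_le _ _
  refine .ite (.le (hu.two_pow hub) (.fold (f := x) (h := fun σ => σ.reg 1 - 1 - u σ)
    (g := fun σ i y => y - if 2 ^ (σ.reg 1 - 1 - i) ≤ y then 2 ^ (σ.reg 1 - 1 - i) else 0)
    (.sub (hL r h2) hu) (hLb.mono fun σ => Nat.sub_le _ _) hx fun s hs i a hi hib ha => ?_))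
    (.lit h2 1) (.lit h2 0)
  have hp : Evaluable (loopBound k) s (fun σ => 2 ^ (σ.reg 1 - 1 - i σ)) :=
    .two_pow (.sub (hL s hi.two_le) hi) (hLb.mono fun σ => Nat.sub_le _ _)
  exact .sub ha (.ite (.le hp ha) hp (.lit hi.two_le 0))

end Evaluable

/-- Filling an array by course-of-values recursion. -/
theorem exists_table {N : ℕ → ℕ} (a : ℕ) {g : State → ℕ → ℕ}
    (hg : ∀ s, 2 ≤ s → ∀ i, Evaluable N s i → Bounded N i → Evaluable N s (fun σ => g σ (i σ)))
    (hloc : ∀ (σ τ : State) (j : ℕ), σ.reg = τ.reg → (∀ b ≠ a, σ.arr b = τ.arr b) →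
      (∀ i < j, σ.arr a i = τ.arr a i) → g σ j = g τ j) :
    ∃ (P : Program) (p : Polynomial ℕ), ∀ σ : State, σ.reg 1 = N (σ.reg 0) →
      ∃ k τ, Exec P σ k τ ∧ k ≤ p.eval (σ.reg 1) ∧ τ.reg 0 = σ.reg 0 ∧ τ.reg 1 = σ.reg 1 ∧
        (∀ b ≠ a, τ.arr b = σ.arr b) ∧ ∀ i < σ.reg 1, τ.arr a i = g τ i := by
  obtain ⟨P, p, hP⟩ := exists_fill (N := N) a (f := fun σ => g σ (σ.reg 2 - (σ.reg 2 - σ.reg 1)))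
    (hg 3 (by omega) _ (.sub (.reg (by omega) (by omega)) (.sub (.reg (by omega) (by omega))
      (.reg (by omega) (by omega)))) fun σ _ => by omega)
    (fun σ τ h1 h2 h3 => by
      rw [← h1]
      exact hloc _ _ _ h1 h2 fun i hi => h3 i (by omega))
  refine ⟨P, p, fun σ hσ => ?_⟩
  obtain ⟨k, τ, h1, h2, h3, h4, h5, h6⟩ := hP σ hσ
  refine ⟨k, τ, h1, h2, h3, h4, h5, fun i hi => ?_⟩
  rw [h6 i hi]
  have hr1 : (τ.setReg 2 i).reg 1 = σ.reg 1 := by rw [State.setReg_reg_of_ne _ _ (by omega), h4]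
  have hr0 : (τ.setReg 2 i).reg 0 = σ.reg 0 := by rw [State.setReg_reg_of_ne _ _ (by omega), h3]
  -- At a fixed index `g` is evaluable with `r = 2`, so it ignores register `2`, and the loop
  -- counter left there does not matter.
  have := (hg 2 le_rfl (fun ρ => i - (i - ρ.reg 1)) (.sub (.lit le_rfl _) (.sub (.lit le_rfl _)
    (.reg le_rfl (by omega)))) (fun ρ _ => by beta_reduce; omega)).congr (τ.setReg 2 i) τ
    (by rw [hr1, hr0, hσ]) (fun x hx => State.setReg_reg_of_ne _ _ (by omega)) rfl
  beta_reduce at this ⊢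
  rw [State.setReg_reg_self]
  rw [hr1, h4, Nat.sub_eq_zero_of_le hi.le, Nat.sub_zero] at this
  rw [hr1, Nat.sub_eq_zero_of_le hi.le, Nat.sub_zero, this]

/-- Until the loop bound is available, `n` itself must bound the loops. A factor `n + 2` exceeds it,
so `(n + 2) * y` is computed as `n * y + y + y`. -/
theorem evaluable_id_pow (m : ℕ) : Evaluable id 2 (fun σ => (σ.reg 0 + 2) ^ m) := by
  induction m with
  | zero => simpa using Evaluable.lit le_rfl 1
  | succ m ih =>
    have h := (((Evaluable.reg (N := id) le_rfl (by omega : 0 < 2)).mul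
      (fun σ hσ => hσ.symm.le) ih).add ih).add ih
    convert h using 2 with σ
    ring

/-- Computing the loop bound. -/
theorem exists_loopBound (k : ℕ) : ∃ (P : Program) (p : Polynomial ℕ), ∀ σ : State,
    ∃ l τ, Exec P σ l τ ∧ l ≤ p.eval (σ.reg 0) ∧ τ.reg 0 = σ.reg 0 ∧
      τ.reg 1 = loopBound k (τ.reg 0) ∧ τ.arr = σ.arr := by
  obtain ⟨P, p, hP⟩ := (evaluable_id_pow (3 * k + 3)).exec 2 le_rfl
  refine ⟨.seq (.assign 1 (.reg 0)) (.seq P (.assign 1 (.reg 2))), Polynomial.C 4 + p,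
    fun σ => ?_⟩
  have h0 : (σ.setReg 1 (σ.reg 0)).reg 0 = σ.reg 0 := State.setReg_reg_of_ne _ _ (by omega)
  obtain ⟨l, τ, h1, h2, h3, h4, h5⟩ := hP (σ.setReg 1 (σ.reg 0)) (by
    rw [h0, State.setReg_reg_self]; rfl)
  refine ⟨_, _, .seq (.assign _ _ _) (.seq h1 (.assign _ _ _)), ?_, ?_, ?_, ?_⟩
  · rw [State.setReg_reg_self] at h2
    simp only [Polynomial.eval_add, Polynomial.eval_C, Expr.cost]
    omega
  · rw [State.setReg_reg_of_ne _ _ (by omega), h5 0 (by omega), h0]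
  · rw [State.setReg_reg_self, State.setReg_reg_of_ne _ _ (by omega), h5 0 (by omega)]
    exact h4
  · rw [State.setReg_arr, h3, State.setReg_arr]

theorem storedAdj_eq {n : ℕ} {G : SimpleGraph (Fin n)} {σ : State} (h0 : σ.reg 0 = n)
    (ha : σ.arr 0 = (input G).arr 0) : storedAdj σ = NatAdj G := by
  funext u v
  have key : ∀ (hu : u < n) (hv : v < n), (input G).arr 0 (u * n + v) ≠ 0 ↔
      G.Adj ⟨u, hu⟩ ⟨v, hv⟩ := by
    intro hu hv
    have : (∃ u' v' : Fin n, u * n + v = (u' : ℕ) * n + (v' : ℕ) ∧ G.Adj u' v') ↔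
        G.Adj ⟨u, hu⟩ ⟨v, hv⟩ := by
      constructor
      · rintro ⟨u', v', h, hadj⟩
        have hd : ∀ x y : ℕ, y < n → (x * n + y) / n = x := fun x y hy => by
          rw [mul_comm, Nat.mul_add_div (by omega), Nat.div_eq_of_lt hy, add_zero]
        have hm : ∀ x y : ℕ, y < n → (x * n + y) % n = y := fun x y hy => by
          rw [mul_comm, Nat.mul_add_mod, Nat.mod_eq_of_lt hy]
        have e1 := hd u v hv
        have e2 := hm u v hv
        rw [h, hd _ _ v'.2] at e1
        rw [h, hm _ _ v'.2] at e2
        subst e1 e2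
        exact hadj
      · exact fun h => ⟨_, _, rfl, h⟩
    unfold input
    simp [this]
  refine propext ⟨?_, ?_⟩
  · rintro ⟨⟨hu, hv⟩, h⟩
    rw [h0] at hu hv h
    rw [ha] at h
    exact ⟨hu, hv, (key hu hv).1 h⟩
  · rintro ⟨hu, hv, h⟩
    refine ⟨⟨h0 ▸ hu, h0 ▸ hv⟩, ?_⟩
    rw [h0, ha]
    exact (key hu hv).2 h

end RAM

/-- The left side bounds the optimum, so `loopBound` many binary positions suffice for it. -/
theorem two_pow_mul_lt {n k : ℕ} (hk : 0 < k) :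
    2 ^ n * ((n * n + 1) * (n + 1)) ≤ 2 ^ (RAM.loopBound k n) := by
  have h1 : (n * n + 1) * (n + 1) ≤ (n + 2) ^ 3 := by ring_nf; nlinarith
  have h2 : (n + 2) ^ 3 < 2 ^ ((n + 2) ^ 3) := Nat.lt_two_pow_self
  have h3 : n + (n + 2) ^ 3 ≤ RAM.loopBound k n := by
    have h4 : (n + 2) ^ 6 ≤ RAM.loopBound k n := Nat.pow_le_pow_right (by omega) (by omega)
    have h5 : (n + 2) ^ 6 = (n + 2) ^ 3 * (n + 2) ^ 3 := by ring
    have h6 : n + 2 ≤ (n + 2) ^ 3 := Nat.le_self_pow (by omega) _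
    nlinarith
  calc 2 ^ n * ((n * n + 1) * (n + 1)) ≤ 2 ^ n * 2 ^ ((n + 2) ^ 3) :=
        Nat.mul_le_mul_left _ (h1.trans h2.le)
    _ = 2 ^ (n + (n + 2) ^ 3) := (pow_add _ _ _).symm
    _ ≤ _ := Nat.pow_le_pow_right (by omega) h3

/-- There is a program that solves Connected Maximum Cut in polynomial time for treewidth `t`. -/
theorem exists_program (t : ℕ) : ∃ P : RAM.Program,
    SolvesCMCInPolyTime P (fun _ G => treewidth G ≤ t) := by
  set k := t + 1 with hk
  obtain ⟨P₁, p₁, h₁⟩ := RAM.exists_loopBound k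
  -- Array `2` holds reachability; its layer `s = n` gives the components.
  obtain ⟨P₂, p₂, h₂⟩ := RAM.exists_table (N := RAM.loopBound k) 2
    (g := fun σ j => reachRule (σ.reg 0) k (RAM.storedAdj σ) (RAM.below 2 σ j)
      (j / (σ.reg 0 + 2) / (σ.reg 0 + 2) / (σ.reg 0 + 2) ^ (3 * k))
      (j / (σ.reg 0 + 2) / (σ.reg 0 + 2) % (σ.reg 0 + 2) ^ (3 * k))
      (j / (σ.reg 0 + 2) % (σ.reg 0 + 2)) (j % (σ.reg 0 + 2)))
    (fun s hs j hj hjb => RAM.evaluable_decode (rule := fun σ j => reachRule (σ.reg 0) k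
      (RAM.storedAdj σ) (RAM.below 2 σ j)) (fun _ _ _ _ hs hq hqb hx hy =>
      RAM.evaluable_reachRule hj hs hq hqb hx hy) hj hjb)
    (fun σ τ j hr hb ha => by
      have e1 : RAM.storedAdj σ = RAM.storedAdj τ := by
        unfold RAM.storedAdj; rw [hr, hb 0 (by omega)]
      have e2 : RAM.below 2 σ j = RAM.below 2 τ j := by
        funext i; unfold RAM.below; split_ifs with h
        · exact ha i h
        · rfl
      rw [e1, e2, hr])
  -- Array `3` holds the values for all roots, with the components read from array `2`.
  obtain ⟨P₃, p₃, h₃⟩ := RAM.exists_table (N := RAM.loopBound k) 3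
    (g := fun σ j => valueRule (σ.reg 0) k (RAM.storedAdj σ) (RAM.storedComp k σ) (RAM.below 3 σ j)
      (j / (σ.reg 0 + 2) / (σ.reg 0 + 2) / (σ.reg 0 + 2) ^ (3 * k))
      (j / (σ.reg 0 + 2) / (σ.reg 0 + 2) % (σ.reg 0 + 2) ^ (3 * k))
      (j / (σ.reg 0 + 2) % (σ.reg 0 + 2)) (j % (σ.reg 0 + 2)))
    (fun s hs j hj hjb => RAM.evaluable_decode (rule := fun σ j => valueRule (σ.reg 0) k
      (RAM.storedAdj σ) (RAM.storedComp k σ) (RAM.below 3 σ j)) (fun _ _ _ _ hs hq hqb hx hy =>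
      RAM.evaluable_valueRule hj hs hq hqb hx hy) hj hjb)
    (fun σ τ j hr hb ha => by
      have e1 : RAM.storedAdj σ = RAM.storedAdj τ := by
        unfold RAM.storedAdj; rw [hr, hb 0 (by omega)]
      have e2 : RAM.below 3 σ j = RAM.below 3 τ j := by
        funext i; unfold RAM.below; split_ifs with h
        · exact ha i h
        · rfl
      have e3 : RAM.storedComp k σ = RAM.storedComp k τ := by
        unfold RAM.storedComp; rw [hr, hb 2 (by omega)]
      rw [e1, e2, e3, hr])
  -- Array `1` receives the binary digits of the optimum, which is evaluated anew for each digit.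
  obtain ⟨P₄, p₄, h₄⟩ := RAM.exists_table (N := RAM.loopBound k) 1
    (g := fun σ j => RAM.digit (σ.reg 1) (optimum (σ.reg 0) (RAM.storedComp k σ) fun r q c =>
      σ.arr 3 (cell (σ.reg 0 + 2) k (σ.reg 0) q r c)) j)
    (fun s hs j hj hjb => RAM.evaluable_digit (RAM.evaluable_optimum (T := fun σ r q c =>
      σ.arr 3 (cell (σ.reg 0 + 2) k (σ.reg 0) q r c)) (fun s hs v q c hv hq hc =>
      .arr 3 (RAM.evaluable_cell (RAM.evaluable_size hv.two_le) hq hv hc)) hs) hj hjb)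
    (fun σ τ j hr hb ha => by
      have e3 : RAM.storedComp k σ = RAM.storedComp k τ := by
        unfold RAM.storedComp; rw [hr, hb 2 (by omega)]
      rw [e3, hr, hb 3 (by omega)])
  -- The last three running times are polynomial in the loop bound, which is a polynomial in `n`.
  refine ⟨.seq P₁ (.seq P₂ (.seq P₃ P₄)), p₁ + (p₂ + p₃ + p₄).comp
    ((Polynomial.X + Polynomial.C 2) ^ (3 * k + 3)), fun n hn G hG => ?_⟩
  obtain ⟨k₁, σ₁, x₁, l₁, n₁, N₁, a₁⟩ := h₁ (RAM.input G)
  have hin : (RAM.input G).reg 0 = n := rfl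
  rw [hin] at l₁ n₁
  rw [n₁] at N₁
  obtain ⟨k₂, σ₂, x₂, l₂, n₂, N₂, a₂, v₂⟩ := h₂ σ₁ (by rw [N₁, n₁])
  rw [n₁] at n₂
  rw [N₁] at N₂ l₂ v₂
  obtain ⟨k₃, σ₃, x₃, l₃, n₃, N₃, a₃, v₃⟩ := h₃ σ₂ (by rw [N₂, n₂])
  rw [n₂] at n₃
  rw [N₂] at N₃ l₃ v₃
  obtain ⟨k₄, σ₄, x₄, l₄, n₄, N₄, a₄, v₄⟩ := h₄ σ₃ (by rw [N₃, n₃])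
  rw [n₃] at n₄
  rw [N₃] at N₄ l₄ v₄
  have A₂ : RAM.storedAdj σ₂ = NatAdj G := RAM.storedAdj_eq n₂ (by rw [a₂ 0 (by omega), a₁])
  have A₃ : RAM.storedAdj σ₃ = NatAdj G :=
    RAM.storedAdj_eq n₃ (by rw [a₃ 0 (by omega), a₂ 0 (by omega), a₁])
  have T₂ : ∀ j < (n + 2) ^ (3 * k + 3),
      Obeys (n + 2) k (reachRule n k (NatAdj G)) (σ₂.arr 2) j := by
    intro j hj
    have := v₂ j hj
    rw [A₂, n₂] at this
    exact this
  have C₂ : ∀ q < (n + 2) ^ (3 * k), ∀ c < n + 2, ∀ u < n + 2,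
      σ₂.arr 2 (cell (n + 2) k n q c u) ≠ 0 ↔ component k n (NatAdj G) q c u :=
    fun q hq c hc u hu => reach_table (NatAdj.lt G) T₂ hq hc hu
  have C₃ : ∀ q < (n + 2) ^ (3 * k), ∀ c < n + 2, ∀ u < n + 2,
      RAM.storedComp k σ₃ q c u ↔ component k n (NatAdj G) q c u := by
    intro q hq c hc u hu
    rw [← C₂ q hq c hc u hu, RAM.storedComp, n₃, a₃ 2 (by omega)]
  have C₄ : ∀ q < (n + 2) ^ (3 * k), ∀ c < n + 2, ∀ u < n + 2,
      RAM.storedComp k σ₄ q c u ↔ component k n (NatAdj G) q c u := by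
    intro q hq c hc u hu
    rw [← C₂ q hq c hc u hu, RAM.storedComp, n₄, a₄ 2 (by omega), a₃ 2 (by omega)]
  have T₃ : ∀ j < (n + 2) ^ (3 * k + 3),
      Obeys (n + 2) k (valueRule n k (NatAdj G) (RAM.storedComp k σ₃)) (σ₃.arr 3) j := by
    intro j hj
    have := v₃ j hj
    rw [A₃, n₃] at this
    exact this
  have h0K : 0 < (n + 2) ^ (3 * k) := by positivity
  set x := optimum (σ₄.reg 0) (RAM.storedComp k σ₄) fun r q c =>
      σ₄.arr 3 (cell (σ₄.reg 0 + 2) k (σ₄.reg 0) q r c) with hx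
  have hxo : x = optimum n (component k n (NatAdj G))
      fun r => value (n + 2) n (NatAdj G) k (cmcWeight n (NatAdj G) r) n := by
    rw [hx, n₄]
    refine optimum_congr (fun c hc u hu => C₄ 0 h0K c (by omega) u (by omega))
      fun r hr c hc => ?_
    rw [a₄ 3 (by omega)]
    exact value_table C₃ T₃ (by omega) n (by omega) 0 h0K c (by omega)
  obtain ⟨hopt, hlt⟩ := isOptimalCMC_bits hn hG hxo
  refine ⟨_, σ₄, .seq x₁ (.seq x₂ (.seq x₃ x₄)), ?_, ?_⟩
  · simp only [Polynomial.eval_add, Polynomial.eval_comp, Polynomial.eval_pow, Polynomial.eval_X,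
      Polynomial.eval_C]
    change _ ≤ _ + (p₂.eval (RAM.loopBound k n) + p₃.eval (RAM.loopBound k n) +
      p₄.eval (RAM.loopBound k n))
    omega
  · convert hopt using 1
    ext v
    have hvN : (v : ℕ) < RAM.loopBound k n :=
      v.2.trans_le ((by omega : n ≤ n + 2).trans (Nat.le_self_pow (by omega) _))
    change σ₄.arr 1 (v : ℕ) ≠ 0 ↔ _
    rw [v₄ v hvN, N₄, RAM.digit_ne_zero (hlt.trans_le (two_pow_mul_lt (by omega))) hvN]
    rfl

end ConnMaxCut

theorem mainTheorem5 (t : ℕ) :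
    ∃ P : ConnMaxCut.RAM.Program,
      ConnMaxCut.SolvesCMCInPolyTime P (fun _ G => ConnMaxCut.treewidth G ≤ t) :=
  ConnMaxCut.exists_program t
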